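/- Let $E=(E^0,E^1,r,s)$ be a directed graph with countable sets $E^0\neq\emptyset$ of vertices and $E^1$ of edges, range and source maps $r,s:E^1\to E^0$, and let $R$ be a nonzero commutative ring with unit. Let $L_R(E)$ be the Leavitt path algebra: the universal (not necessarily unital) $R$-algebra generated by elements $v$ ($v\in E^0$), $e,e^*$ ($e\in E^1$) such that the $v$ are pairwise orthogonal idempotents, $s(e)e=e\,r(e)=e$ and $r(e)e^*=e^*s(e)=e^*$ for every $e\in E^1$, $e^*f=\delta_{e,f}\,r(e)$ for all $e,f\in E^1$, and $v=\sum_{s(e)=v}ee^*$ whenever $0<|s^{-1}(v)|<\infty$. Ideals of $L_R(E)$ are two-sided, and for an ideal $I$ we write $I\cap E^0$ for the set of vertices $v$ whose image in $L_R(E)$ lies in $I$. An ideal $I$ is called *basic* if, for every $t\in R\setminus\{0\}$ and every $x=v-\sum_{i=1}^n e_ie_i^*$ with $v\in E^0$, $n\ge 0$ and $e_1,\dots,e_n$ distinct edges with source $v$ (so $x=v$ if $n=0$), $tx\in I$ implies $x\in I$. A path of length $n\ge1$ is a sequence of edges $e_1\cdots e_n$ with $r(e_i)=s(e_{i+1})$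 for $1\le i<n$; its source is $s(e_1)$ and its range is $r(e_n)$. Vertices are paths of length $0$. A closed simple path is a path $e_1\cdots e_n$ with $n\geq 1$, $r(e_n)=s(e_1)$ and $s(e_i)\ne s(e_1)$ for all $i>1$; it has an exit if there are an $i$ and an edge $f\neq e_i$ with $s(f)=s(e_i)$. The graph $E$ satisfies Condition (L) if every closed simple path has an exit. It satisfies Condition (MT3) if for all $v,w\in E^0$ there is $y\in E^0$ such that there are paths (possibly of length $0$) from $v$ to $y$ and from $w$ to $y$. Then: 1. $E$ satisfies Condition (L) if and only if $I\cap E^0\neq\emptyset$ for every nonzero basic ideal $I$ of $L_R(E)$. 2. $E$ satisfies Conditions (L) and (MT3) if and only if $I\cap J\cap E^0\neq\emptyset$ for all nonzero basic ideals $I$ and $J$ of $L_R(E)$. 3. $R$ is a field and $E$ satisfies Conditions (L) and (MT3) if and only if $I\cap J\cap E^0\neq\emptyset$ for all nonzero ideals $I$ and $J$ of $L_R(E)$. -/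

import Mathlib

universe u v w

/-- A directed graph `E = (E⁰, E¹, r, s)` with vertex set `V`, edge set `Ed`, source map `s` and
range map `r`; loops and multiple edges are allowed. -/
structure DirectedGraph (V : Type u) (Ed : Type v) where
  /-- source map -/
  s : Ed → V
  /-- range map -/
  r : Ed → V

namespace DirectedGraph

/-- `E.IsPath a p b`: the list of edges `p = e₁ … eₙ` is a path (`r(eᵢ) = s(eᵢ₊₁)`) with source `a`
and range `b`; the empty list is the path of length zero at a vertex. -/
def IsPath {V : Type u} {Ed : Type v} (E : DirectedGraph V Ed) : V → List Ed → V → Prop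
  | a, [], b => a = b
  | a, e :: p, b => E.s e = a ∧ E.IsPath (E.r e) p b

/-- `a ≥ b`: there is a path (possibly of length zero) from `a` to `b`. -/
def Reaches {V : Type u} {Ed : Type v} (E : DirectedGraph V Ed) (a b : V) : Prop :=
  ∃ p : List Ed, E.IsPath a p b

/-- `p = e₁ … eₙ` (with `n ≥ 1`) is a closed simple path: `s(p) = r(p)`, and `s(eᵢ) ≠ s(e₁)`
for all `i > 1`. -/
def IsClosedSimplePath {V : Type u} {Ed : Type v} (E : DirectedGraph V Ed) : List Ed → Prop
  | [] => False
  | e :: p => E.IsPath (E.s e) (e :: p) (E.s e) ∧ ∀ f ∈ p, E.s f ≠ E.s e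

/-- A path has an exit if some edge `f` starts at the source of an edge `e` of the path
and `f ≠ e`. -/
def HasExit {V : Type u} {Ed : Type v} (E : DirectedGraph V Ed) (p : List Ed) : Prop :=
  ∃ e ∈ p, ∃ f : Ed, E.s f = E.s e ∧ f ≠ e

/-- Condition (L): every closed simple path has an exit. -/
def ConditionL {V : Type u} {Ed : Type v} (E : DirectedGraph V Ed) : Prop :=
  ∀ p : List Ed, E.IsClosedSimplePath p → E.HasExit p

/-- Condition (MT3) for the whole vertex set: any two vertices have a common descendant. -/
def ConditionMT3 {V : Type u} {Ed : Type v} (E : DirectedGraph V Ed) : Prop :=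
  ∀ a b : V, ∃ y : V, E.Reaches a y ∧ E.Reaches b y

end DirectedGraph

/-- `a`, `b`, `c` (the images of the vertices `v`, the edges `e` and the ghost edges `e*`) form a
Leavitt `E`-family in the (not necessarily unital) ring `A`. -/
structure IsLeavittFamily {V : Type u} {Ed : Type v} (E : DirectedGraph V Ed)
    {A : Type*} [NonUnitalRing A] (a : V → A) (b c : Ed → A) : Prop where
  idem : ∀ x, a x * a x = a x
  orth : ∀ x y, x ≠ y → a x * a y = 0
  source_edge : ∀ e, a (E.s e) * b e = b e
  edge_range : ∀ e, b e * a (E.r e) = b e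
  range_ghost : ∀ e, a (E.r e) * c e = c e
  ghost_source : ∀ e, c e * a (E.s e) = c e
  ghost_edge : ∀ e, c e * b e = a (E.r e)
  ghost_edge_ne : ∀ e f, e ≠ f → c e * b f = 0
  /-- `F` is the set `s⁻¹(x)`, supposed nonempty and finite. -/
  sum_edge_ghost : ∀ (x : V) (F : Finset Ed), F.Nonempty → (∀ e, e ∈ F ↔ E.s e = x) →
    a x = ∑ e ∈ F, b e * c e

namespace LeavittPathAlgebra

/-- The generators of the Leavitt path algebra: vertices, (real) edges and ghost edges. -/
inductive Gen (V : Type u) (Ed : Type v) : Type (max u v)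
  | vertex (x : V)
  | edge (e : Ed)
  | ghost (e : Ed)

/-- The free associative non-unital `R`-algebra on the generators: finite `R`-linear combinations
of nonempty words. -/
abbrev Free (R : Type w) [CommRing R] (V : Type u) (Ed : Type v) : Type (max u v w) :=
  MonoidAlgebra R (FreeSemigroup (Gen V Ed))

/-- A generator, as an element of the free algebra. -/
noncomputable def Free.of (R : Type w) [CommRing R] {V : Type u} {Ed : Type v} (x : Gen V Ed) :
    Free R V Ed :=
  MonoidAlgebra.single (FreeSemigroup.of x) 1

open Gen in
/-- The defining relations of a Leavitt `E`-family, and their `R`-multiples. -/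
inductive Rel (R : Type w) [CommRing R] {V : Type u} {Ed : Type v} (E : DirectedGraph V Ed) :
    Free R V Ed → Free R V Ed → Prop
  | idem (x : V) : Rel R E (Free.of R (vertex x) * Free.of R (vertex x)) (Free.of R (vertex x))
  | orth (x y : V) : x ≠ y → Rel R E (Free.of R (vertex x) * Free.of R (vertex y)) 0
  | source_edge (e : Ed) :
      Rel R E (Free.of R (vertex (E.s e)) * Free.of R (edge e)) (Free.of R (edge e))
  | edge_range (e : Ed) :
      Rel R E (Free.of R (edge e) * Free.of R (vertex (E.r e))) (Free.of R (edge e))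
  | range_ghost (e : Ed) :
      Rel R E (Free.of R (vertex (E.r e)) * Free.of R (ghost e)) (Free.of R (ghost e))
  | ghost_source (e : Ed) :
      Rel R E (Free.of R (ghost e) * Free.of R (vertex (E.s e))) (Free.of R (ghost e))
  | ghost_edge (e : Ed) :
      Rel R E (Free.of R (ghost e) * Free.of R (edge e)) (Free.of R (vertex (E.r e)))
  | ghost_edge_ne (e f : Ed) : e ≠ f → Rel R E (Free.of R (ghost e) * Free.of R (edge f)) 0
  | sum_edge_ghost (x : V) (F : Finset Ed) : F.Nonempty → (∀ e, e ∈ F ↔ E.s e = x) →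
      Rel R E (Free.of R (vertex x)) (∑ e ∈ F, Free.of R (edge e) * Free.of R (ghost e))
  | smul (t : R) {a b : Free R V Ed} : Rel R E a b → Rel R E (t • a) (t • b)

/-- The congruence generated by the defining relations. -/
noncomputable def con (R : Type w) [CommRing R] {V : Type u} {Ed : Type v} (E : DirectedGraph V Ed) :
    RingCon (Free R V Ed) :=
  ringConGen (Rel R E)

theorem con_smul {R : Type w} [CommRing R] {V : Type u} {Ed : Type v} {E : DirectedGraph V Ed}
    (t : R) {a b : Free R V Ed} (h : con R E a b) : con R E (t • a) (t • b) := by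
  have h' : RingConGen.Rel (Rel R E) a b := h
  change RingConGen.Rel (Rel R E) (t • a) (t • b)
  clear h
  induction h' with
  | of _ _ h => exact .of _ _ (h.smul t)
  | refl _ => exact .refl _
  | symm _ ih => exact ih.symm
  | trans _ _ ih₁ ih₂ => exact ih₁.trans ih₂
  | add _ _ ih₁ ih₂ => rw [smul_add, smul_add]; exact ih₁.add ih₂
  | mul _ h₂ ih₁ _ => rw [← smul_mul_assoc, ← smul_mul_assoc]; exact ih₁.mul h₂

end LeavittPathAlgebra

/-- The Leavitt path algebra `L_R(E)`: the universal (not necessarily unital) `R`-algebra generated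
by a Leavitt `E`-family, constructed as the quotient of the free non-unital `R`-algebra on the
vertices, edges and ghost edges by the defining relations. -/
noncomputable def LeavittPathAlgebra (R : Type w) [CommRing R] {V : Type u} {Ed : Type v}
    (E : DirectedGraph V Ed) : Type (max u v w) :=
  (LeavittPathAlgebra.con R E).Quotient

namespace LeavittPathAlgebra

noncomputable instance instNonUnitalRing (R : Type w) [CommRing R] {V : Type u} {Ed : Type v}
    (E : DirectedGraph V Ed) : NonUnitalRing (LeavittPathAlgebra R E) :=
  inferInstanceAs (NonUnitalRing (con R E).Quotient)

/-- The quotient map from the free algebra. -/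
noncomputable def mk (R : Type w) [CommRing R] {V : Type u} {Ed : Type v} (E : DirectedGraph V Ed)
    (a : Free R V Ed) : LeavittPathAlgebra R E :=
  (con R E).toQuotient a

theorem mk_surjective (R : Type w) [CommRing R] {V : Type u} {Ed : Type v}
    (E : DirectedGraph V Ed) : Function.Surjective (mk R E) :=
  Quotient.mk''_surjective

theorem mk_eq {R : Type w} [CommRing R] {V : Type u} {Ed : Type v}
    {E : DirectedGraph V Ed} {a b : Free R V Ed} : mk R E a = mk R E b ↔ con R E a b :=
  RingCon.eq _

theorem mk_add {R : Type w} [CommRing R] {V : Type u} {Ed : Type v}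
    {E : DirectedGraph V Ed} (a b : Free R V Ed) : mk R E (a + b) = mk R E a + mk R E b := rfl

theorem mk_mul {R : Type w} [CommRing R] {V : Type u} {Ed : Type v}
    {E : DirectedGraph V Ed} (a b : Free R V Ed) : mk R E (a * b) = mk R E a * mk R E b := rfl

theorem mk_zero {R : Type w} [CommRing R] {V : Type u} {Ed : Type v}
    {E : DirectedGraph V Ed} : mk R E 0 = 0 := rfl

noncomputable instance instSMul (R : Type w) [CommRing R] {V : Type u} {Ed : Type v}
    (E : DirectedGraph V Ed) : SMul R (LeavittPathAlgebra R E) where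
  smul t := Quotient.map' (t • ·) (fun _ _ h => con_smul t h)

theorem mk_smul {R : Type w} [CommRing R] {V : Type u} {Ed : Type v}
    {E : DirectedGraph V Ed} (t : R) (a : Free R V Ed) : mk R E (t • a) = t • mk R E a := rfl

noncomputable instance instModule (R : Type w) [CommRing R] {V : Type u} {Ed : Type v}
    (E : DirectedGraph V Ed) : Module R (LeavittPathAlgebra R E) :=
  (mk_surjective R E).module R
    ({ toFun := mk R E, map_zero' := mk_zero, map_add' := mk_add } :
      Free R V Ed →+ LeavittPathAlgebra R E) mk_smul

instance instIsScalarTower (R : Type w) [CommRing R] {V : Type u} {Ed : Type v}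
    (E : DirectedGraph V Ed) :
    IsScalarTower R (LeavittPathAlgebra R E) (LeavittPathAlgebra R E) where
  smul_assoc t x y := by
    obtain ⟨a, rfl⟩ := mk_surjective R E x
    obtain ⟨b, rfl⟩ := mk_surjective R E y
    simp only [smul_eq_mul, ← mk_smul, ← mk_mul, smul_mul_assoc]

instance instSMulCommClass (R : Type w) [CommRing R] {V : Type u} {Ed : Type v}
    (E : DirectedGraph V Ed) :
    SMulCommClass R (LeavittPathAlgebra R E) (LeavittPathAlgebra R E) where
  smul_comm t x y := by
    obtain ⟨a, rfl⟩ := mk_surjective R E x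
    obtain ⟨b, rfl⟩ := mk_surjective R E y
    simp only [smul_eq_mul, ← mk_smul, ← mk_mul, mul_smul_comm]

/-- The vertex `x`, as an element of `L_R(E)`. -/
noncomputable def vertex (R : Type w) [CommRing R] {V : Type u} {Ed : Type v}
    (E : DirectedGraph V Ed) (x : V) : LeavittPathAlgebra R E :=
  mk R E (Free.of R (Gen.vertex x))

/-- The edge `e`, as an element of `L_R(E)`. -/
noncomputable def edge (R : Type w) [CommRing R] {V : Type u} {Ed : Type v}
    (E : DirectedGraph V Ed) (e : Ed) : LeavittPathAlgebra R E :=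
  mk R E (Free.of R (Gen.edge e))

/-- The ghost edge `e*`, as an element of `L_R(E)`. -/
noncomputable def ghost (R : Type w) [CommRing R] {V : Type u} {Ed : Type v}
    (E : DirectedGraph V Ed) (e : Ed) : LeavittPathAlgebra R E :=
  mk R E (Free.of R (Gen.ghost e))

theorem mk_sum {R : Type w} [CommRing R] {V : Type u} {Ed : Type v}
    {E : DirectedGraph V Ed} {ι : Type*} (F : Finset ι) (f : ι → Free R V Ed) :
    mk R E (∑ i ∈ F, f i) = ∑ i ∈ F, mk R E (f i) :=
  map_sum ({ toFun := mk R E, map_zero' := mk_zero, map_add' := mk_add } :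
      Free R V Ed →+ LeavittPathAlgebra R E) f F

theorem mk_eq_of_rel {R : Type w} [CommRing R] {V : Type u} {Ed : Type v}
    {E : DirectedGraph V Ed} {a b : Free R V Ed} (h : Rel R E a b) : mk R E a = mk R E b :=
  mk_eq.2 (RingConGen.Rel.of _ _ h)

/-- The generators form a Leavitt `E`-family. -/
theorem isLeavittFamily (R : Type w) [CommRing R] {V : Type u} {Ed : Type v}
    (E : DirectedGraph V Ed) : IsLeavittFamily E (vertex R E) (edge R E) (ghost R E) where
  idem x := mk_eq_of_rel (.idem x)
  orth x y h := mk_eq_of_rel (.orth x y h)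
  source_edge e := mk_eq_of_rel (.source_edge e)
  edge_range e := mk_eq_of_rel (.edge_range e)
  range_ghost e := mk_eq_of_rel (.range_ghost e)
  ghost_source e := mk_eq_of_rel (.ghost_source e)
  ghost_edge e := mk_eq_of_rel (.ghost_edge e)
  ghost_edge_ne e f h := mk_eq_of_rel (.ghost_edge_ne e f h)
  sum_edge_ghost x F h₁ h₂ := (mk_eq_of_rel (.sum_edge_ghost x F h₁ h₂)).trans (mk_sum F _)

/-- The universal property of `L_R(E)`. -/
theorem existsUnique_lift {R : Type w} [CommRing R] {V : Type u} {Ed : Type v}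
    {E : DirectedGraph V Ed} {A : Type*} [NonUnitalRing A] [Module R A] [IsScalarTower R A A]
    [SMulCommClass R A A] {a : V → A} {b c : Ed → A} (h : IsLeavittFamily E a b c) :
    ∃! φ : LeavittPathAlgebra R E →ₙₐ[R] A,
      (∀ x, φ (vertex R E x) = a x) ∧ (∀ e, φ (edge R E e) = b e) ∧
        ∀ e, φ (ghost R E e) = c e := by
  let g : Gen V Ed → A := fun x => match x with
    | .vertex x => a x
    | .edge e => b e
    | .ghost e => c e
  let ψ : Free R V Ed →ₙₐ[R] A := MonoidAlgebra.liftMagma R (FreeSemigroup.lift g)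
  have hψ : ∀ x, ψ (Free.of R x) = g x := fun x => by
    simp [ψ, Free.of, MonoidAlgebra.liftMagma_apply_apply]
  have hrel : ∀ p q, Rel R E p q → ψ p = ψ q := by
    intro p q hpq
    induction hpq with
    | idem x => simpa [hψ] using h.idem x
    | orth x y hxy => simpa [hψ] using h.orth x y hxy
    | source_edge e => simpa [hψ] using h.source_edge e
    | edge_range e => simpa [hψ] using h.edge_range e
    | range_ghost e => simpa [hψ] using h.range_ghost e
    | ghost_source e => simpa [hψ] using h.ghost_source e
    | ghost_edge e => simpa [hψ] using h.ghost_edge e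
    | ghost_edge_ne e f hef => simpa [hψ] using h.ghost_edge_ne e f hef
    | sum_edge_ghost x F h₁ h₂ => simpa [hψ] using h.sum_edge_ghost x F h₁ h₂
    | smul t _ ih => rw [map_smul, map_smul, ih]
  have hcon : ∀ p q, con R E p q → ψ p = ψ q := by
    intro p q hpq
    have hpq' : RingConGen.Rel (Rel R E) p q := hpq
    clear hpq
    induction hpq' with
    | of _ _ h => exact hrel _ _ h
    | refl _ => rfl
    | symm _ ih => exact ih.symm
    | trans _ _ ih₁ ih₂ => exact ih₁.trans ih₂
    | add _ _ ih₁ ih₂ => rw [map_add, map_add, ih₁, ih₂]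
    | mul _ _ ih₁ ih₂ => rw [map_mul, map_mul, ih₁, ih₂]
  let φ₀ : LeavittPathAlgebra R E → A := fun x => Quotient.liftOn' x ψ hcon
  have hφ₀ : ∀ p, φ₀ (mk R E p) = ψ p := fun _ => rfl
  let φ : LeavittPathAlgebra R E →ₙₐ[R] A :=
    { toFun := φ₀
      map_smul' := by
        intro t x
        obtain ⟨p, rfl⟩ := mk_surjective R E x
        rw [← mk_smul, hφ₀, hφ₀, map_smul]; rfl
      map_zero' := by rw [← mk_zero, hφ₀, map_zero]
      map_add' := by
        intro x y
        obtain ⟨p, rfl⟩ := mk_surjective R E x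
        obtain ⟨q, rfl⟩ := mk_surjective R E y
        rw [← mk_add, hφ₀, hφ₀, hφ₀, map_add]
      map_mul' := by
        intro x y
        obtain ⟨p, rfl⟩ := mk_surjective R E x
        obtain ⟨q, rfl⟩ := mk_surjective R E y
        rw [← mk_mul, hφ₀, hφ₀, hφ₀, map_mul] }
  refine ⟨φ, ⟨fun x => hψ (.vertex x), fun e => hψ (.edge e), fun e => hψ (.ghost e)⟩, ?_⟩
  rintro θ ⟨h₁, h₂, h₃⟩
  let π : Free R V Ed →ₙₐ[R] LeavittPathAlgebra R E :=
    { toFun := mk R E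
      map_smul' := mk_smul
      map_zero' := mk_zero
      map_add' := mk_add
      map_mul' := mk_mul }
  have key : θ.comp π = ψ := by
    apply (MonoidAlgebra.liftMagma R).symm.injective
    apply FreeSemigroup.hom_ext
    funext x
    change θ (mk R E (Free.of R x)) = ψ (Free.of R x)
    rw [hψ]
    cases x with
    | vertex x => exact h₁ x
    | edge e => exact h₂ e
    | ghost e => exact h₃ e
  ext x
  obtain ⟨p, rfl⟩ := mk_surjective R E x
  exact DFunLike.congr_fun key p

/-- A two-sided ideal `I` of `L_R(E)` is basic if `r x ∈ I` with `r ≠ 0` implies `x ∈ I`, whenever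
`x` is a vertex or `x = v - ∑ eᵢ eᵢ*` for finitely many distinct edges `eᵢ` with source `v`
(no edges: `x = v`). -/
def IsBasic {R : Type w} [CommRing R] {V : Type u} {Ed : Type v} {E : DirectedGraph V Ed}
    (I : TwoSidedIdeal (LeavittPathAlgebra R E)) : Prop :=
  ∀ (t : R) (x : V) (F : Finset Ed), t ≠ 0 → (∀ e ∈ F, E.s e = x) →
    t • (vertex R E x - ∑ e ∈ F, edge R E e * ghost R E e) ∈ I →
      vertex R E x - ∑ e ∈ F, edge R E e * ghost R E e ∈ I

end LeavittPathAlgebra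

/-! The implications from the graph conditions rest on a reduction theorem: under (L), every nonzero
element `a` satisfies `c * a * d = t • y` with `t ≠ 0` and `y` a vertex
(`exists_mul_mul_eq_smul_vertex`). A nonzero basic ideal therefore contains a vertex. Ideals are
hereditary on vertices, so under (MT3) the vertices found in two ideals have a common descendant
lying in both. Over a field every ideal is basic.

For the reduction, right multiplication by edges removes ghost edges until only a combination of
real paths matters. Multiplying on the left by `p*`, with `p` of minimal length in it, gives `t • x`
plus closed paths `q` of positive length at `x`. By (L) there is a path `p` from `x` that is not a
prefix of any `q p`, so that `p* q p = 0`, and conjugating by this `p` leaves `t` times a vertex.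

The converses use representations on functions `X → R`, where edges act through partial bijections
of `X`. The kernel of such a representation is basic, because `v - ∑ e e*` acts as the indicator
function of a set. On `V × ℕ × ℤ` edges can be made to shift the last coordinate by any fixed `d`.
If a closed path `q` at `v` has no exit, then `v - q` acts as zero for `d = 0` but not for `d = 1`,
so the kernel for `d = 0` is a nonzero basic ideal, and it contains no vertex. Restricting to the
complement of a hereditary and saturated set `H` gives a basic ideal whose vertices are those of
`H`; suitable choices of `H` yield (MT3). Finally, if the ideal of multiples of `t ≠ 0` contains a
vertex, then `t` is a unit. -/

namespace DirectedGraph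

/-! ### Paths, closed paths and exits -/

variable {V : Type u} {Ed : Type v} {E : DirectedGraph V Ed}

theorem IsPath.append {a b c : V} {p q : List Ed} (hp : E.IsPath a p b) (hq : E.IsPath b q c) :
    E.IsPath a (p ++ q) c := by
  induction p generalizing a with
  | nil => cases hp; exact hq
  | cons e p ih => exact ⟨hp.1, ih hp.2⟩

theorem isPath_append {a c : V} {p q : List Ed} :
    E.IsPath a (p ++ q) c ↔ ∃ b, E.IsPath a p b ∧ E.IsPath b q c := by
  refine ⟨fun h => ?_, fun ⟨b, hp, hq⟩ => hp.append hq⟩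
  induction p generalizing a with
  | nil => exact ⟨a, rfl, h⟩
  | cons e p ih =>
    obtain ⟨b, h₁, h₂⟩ := ih h.2
    exact ⟨b, ⟨h.1, h₁⟩, h₂⟩

theorem IsPath.range_unique {a b c : V} {p : List Ed} (hb : E.IsPath a p b)
    (hc : E.IsPath a p c) : b = c := by
  induction p generalizing a with
  | nil => exact hb.symm.trans hc
  | cons e p ih => exact ih hb.2 hc.2

theorem Reaches.refl (a : V) : E.Reaches a a := ⟨[], rfl⟩

theorem Reaches.trans {a b c : V} : E.Reaches a b → E.Reaches b c → E.Reaches a c :=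
  fun ⟨p, hp⟩ ⟨q, hq⟩ => ⟨p ++ q, hp.append hq⟩

theorem reaches_edge (e : Ed) : E.Reaches (E.s e) (E.r e) := ⟨[e], rfl, rfl⟩

/-- Under Condition (L), closed paths that are not necessarily simple have exits as well. -/
theorem ConditionL.hasExit (hL : E.ConditionL) {a : V} {q : List Ed} (hq : E.IsPath a q a)
    (hne : q ≠ []) : E.HasExit q := by
  induction hn : q.length using Nat.strong_induction_on generalizing q with
  | _ n ih =>
    match q, hne with
    | e :: p, _ =>
      obtain rfl : E.s e = a := hq.1
      by_cases hs : ∀ f ∈ p, E.s f ≠ E.s e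
      · exact hL _ ⟨hq, hs⟩
      · push Not at hs
        obtain ⟨f, hf, hfe⟩ := hs
        obtain ⟨p₁, p₂, rfl⟩ := List.append_of_mem hf
        obtain ⟨b, h₁, h₂⟩ := isPath_append.1 hq.2
        obtain rfl : E.s e = b := hfe.symm.trans h₂.1
        obtain ⟨e', he', f', h⟩ := ih (e :: p₁).length (by simp at hn ⊢; omega)
          (q := e :: p₁) ⟨rfl, h₁⟩ (by simp) rfl
        exact ⟨e', by simp at he' ⊢; tauto, f', h⟩

theorem isPath_flatten_replicate {a : V} {q : List Ed} (hq : E.IsPath a q a) (k : ℕ) :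
    E.IsPath a (List.replicate k q).flatten a := by
  induction k with
  | zero => rfl
  | succ k ih => rw [List.replicate_succ, List.flatten_cons]; exact hq.append ih

/-- Either `p` is a prefix of `q`, or `p = q p'` and cancelling `q` leaves the same hypothesis for
the shorter `p'`. Hence `p` runs along a power of `q`. -/
theorem exists_isPrefix_flatten_replicate {α : Type*} {p q : List α} (hq : q ≠ [])
    (h : p <+: q ++ p) : ∃ k, p <+: (List.replicate k q).flatten := by
  induction hn : p.length using Nat.strong_induction_on generalizing p with
  | _ n ih =>
    rcases List.prefix_or_prefix_of_prefix h (List.prefix_append q p) with h' | ⟨p', rfl⟩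
    · exact ⟨1, by simpa using h'⟩
    · obtain ⟨k, hk⟩ := ih p'.length
        (by have := List.length_pos_of_ne_nil hq; simp at hn; omega)
        ((List.prefix_append_right_inj q).1 h) rfl
      exact ⟨k + 1, by
        rw [List.replicate_succ, List.flatten_cons]; exact (List.prefix_append_right_inj q).2 hk⟩

theorem ConditionL.exists_extension (hL : E.ConditionL) {a b : V} {q p : List Ed}
    (hq : E.IsPath a q a) (hne : q ≠ []) (hp : E.IsPath a p b) :
    ∃ (p' : List Ed) (c : V), E.IsPath b p' c ∧ ¬ (p ++ p') <+: q ++ (p ++ p') := by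
  by_cases h : p <+: q ++ p
  swap
  · exact ⟨[], b, rfl, by simpa using h⟩
  obtain ⟨k, σ, hσ⟩ := exists_isPrefix_flatten_replicate hne h
  obtain ⟨e, he, f, hfe, hf⟩ := hL.hasExit hq hne
  obtain ⟨q₁, q₂, rfl⟩ := List.append_of_mem he
  have hk := isPath_flatten_replicate hq k
  rw [← hσ] at hk
  obtain ⟨b', h₁, h₂⟩ := isPath_append.1 hk
  obtain rfl := hp.range_unique h₁
  obtain ⟨d, h₃, h₄⟩ := isPath_append.1 hq
  -- Complete `p` to `q ^ k`, then leave `q` through its exit: `p p' = q ^ k q₁ f`. As `q` commutes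
  -- with its powers, `q p p'` begins with `q ^ k q₁ e`, so a prefix relation would force `f = e`.
  refine ⟨σ ++ (q₁ ++ [f]), E.r f, h₂.append (h₃.append ⟨hfe.trans h₄.1, rfl⟩), fun hpre => ?_⟩
  have hcomm : ∀ (k : ℕ) (l : List Ed),
      l ++ (List.replicate k l).flatten = (List.replicate k l).flatten ++ l := by
    intro k l
    induction k with
    | zero => simp
    | succ k ih => rw [List.replicate_succ, List.flatten_cons, List.append_assoc, ih]
  rw [← List.append_assoc p, hσ, ← List.append_assoc _ (List.flatten _), hcomm,
    List.append_assoc, List.prefix_append_right_inj, List.append_assoc,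
    List.prefix_append_right_inj] at hpre
  simp at hpre
  exact hf hpre

/-- Closed paths can be treated one at a time, because failure to be a prefix survives extension: if
`p p'` were a prefix of `q p p'`, comparing lengths would make `p` a prefix of `q p`. The resulting
`p` satisfies `p* q p = 0` for all `q` in `S`. -/
theorem ConditionL.exists_isPath_not_prefix (hL : E.ConditionL) {a : V} (S : Finset (List Ed))
    (hS : ∀ q ∈ S, E.IsPath a q a ∧ q ≠ []) :
    ∃ (p : List Ed) (b : V), E.IsPath a p b ∧ ∀ q ∈ S, ¬ p <+: q ++ p := by
  classical
  induction S using Finset.induction_on with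
  | empty => exact ⟨[], a, rfl, by simp⟩
  | insert q S _ ih =>
    obtain ⟨p, b, hp, hpS⟩ := ih fun q hq => hS q (Finset.mem_insert_of_mem hq)
    obtain ⟨hq, hne⟩ := hS q (Finset.mem_insert_self _ _)
    obtain ⟨p', c, hp', hn⟩ := hL.exists_extension hq hne hp
    refine ⟨p ++ p', c, hp.append hp', fun q' hq' => ?_⟩
    rcases Finset.mem_insert.1 hq' with rfl | hq'
    · exact hn
    · intro h
      apply hpS q' hq'
      refine List.prefix_of_prefix_length_le ((List.prefix_append p p').trans h)
        (l₃ := q' ++ (p ++ p')) ?_ (by simp)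
      exact ⟨p', by simp⟩

end DirectedGraph

/-! ### Products of real paths and ghost paths -/

namespace LeavittPathAlgebra

variable {R : Type w} [CommRing R] {V : Type u} {Ed : Type v} {E : DirectedGraph V Ed}

variable (R E) in
/-- The product of the edges of `p` and of the vertex `x`. -/
noncomputable def path (x : V) : List Ed → LeavittPathAlgebra R E
  | [] => vertex R E x
  | e :: p => edge R E e * path x p

variable (R E) in
/-- The product of the vertex `x` and of the ghost edges of `p` in reverse order. -/
noncomputable def ghostPath (x : V) : List Ed → LeavittPathAlgebra R E
  | [] => vertex R E x
  | e :: p => ghostPath x p * ghost R E e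

theorem vertex_mul_self (x : V) : vertex R E x * vertex R E x = vertex R E x :=
  (isLeavittFamily R E).idem x

theorem vertex_mul_path {a b : V} {p : List Ed} (h : E.IsPath a p b) :
    vertex R E a * path R E b p = path R E b p := by
  cases p with
  | nil => cases h; exact vertex_mul_self _
  | cons e p => rw [path, ← h.1, ← mul_assoc, (isLeavittFamily R E).source_edge]

theorem vertex_mul_path_of_ne {a b c : V} {p : List Ed} (h : E.IsPath a p b) (hc : c ≠ a) :
    vertex R E c * path R E b p = 0 := by
  rw [← vertex_mul_path h, ← mul_assoc, (isLeavittFamily R E).orth _ _ hc, zero_mul]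

theorem path_mul_vertex (b : V) (p : List Ed) :
    path R E b p * vertex R E b = path R E b p := by
  induction p with
  | nil => exact vertex_mul_self _
  | cons e p ih => rw [path, mul_assoc, ih]

theorem path_mul_vertex_of_ne {b c : V} (h : b ≠ c) (p : List Ed) :
    path R E b p * vertex R E c = 0 := by
  rw [← path_mul_vertex, mul_assoc, (isLeavittFamily R E).orth _ _ h, mul_zero]

theorem ghostPath_mul_vertex {a b : V} {p : List Ed} (h : E.IsPath a p b) :
    ghostPath R E b p * vertex R E a = ghostPath R E b p := by
  cases p with
  | nil => cases h; exact vertex_mul_self _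
  | cons e p => rw [ghostPath, ← h.1, mul_assoc, (isLeavittFamily R E).ghost_source]

theorem path_mul_path {a b : V} {p q : List Ed} (hq : E.IsPath a q b) :
    path R E a p * path R E b q = path R E b (p ++ q) := by
  induction p with
  | nil => exact vertex_mul_path hq
  | cons e p ih => rw [path, mul_assoc, ih]; rfl

theorem path_mul_edge (e : Ed) (p : List Ed) :
    path R E (E.s e) p * edge R E e = path R E (E.r e) (p ++ [e]) := by
  rw [← path_mul_path (a := E.s e) (q := [e]) ⟨rfl, rfl⟩, path, path,
    (isLeavittFamily R E).edge_range]

theorem path_mul_edge_of_ne {b : V} {e : Ed} (h : b ≠ E.s e) (p : List Ed) :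
    path R E b p * edge R E e = 0 := by
  rw [← (isLeavittFamily R E).source_edge, ← mul_assoc, path_mul_vertex_of_ne h, zero_mul]

/-- Consecutive edges that do not match multiply to zero by orthogonality of the vertices. This lets
spans indexed by arbitrary lists be cut down to genuine paths. -/
theorem path_eq_zero_or_isPath (b : V) (p : List Ed) :
    path R E b p = 0 ∨ ∃ a, E.IsPath a p b := by
  induction p with
  | nil => exact .inr ⟨b, rfl⟩
  | cons e p ih =>
    rcases ih with ih | ⟨a, ha⟩
    · exact .inl (by rw [path, ih, mul_zero])
    · by_cases h : E.r e = a
      · exact .inr ⟨E.s e, rfl, h ▸ ha⟩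
      · exact .inl (by
          rw [path, ← (isLeavittFamily R E).edge_range, mul_assoc, vertex_mul_path_of_ne ha h,
            mul_zero])

theorem ghostPath_mul_path_append {a b c : V} {p q : List Ed} (hp : E.IsPath a p b)
    (hq : E.IsPath b q c) : ghostPath R E b p * path R E c (p ++ q) = path R E c q := by
  induction p generalizing a with
  | nil => cases hp; exact vertex_mul_path hq
  | cons e p ih =>
    rw [ghostPath, List.cons_append, path, mul_assoc, ← mul_assoc (ghost R E e),
      (isLeavittFamily R E).ghost_edge, vertex_mul_path (hp.2.append hq), ih hp.2]

theorem ghostPath_mul_path_self {a b : V} {p : List Ed} (hp : E.IsPath a p b) :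
    ghostPath R E b p * path R E b p = vertex R E b := by
  simpa [path] using ghostPath_mul_path_append (R := R) (q := []) hp rfl

theorem ghostPath_mul_path_of_not_prefix {a a' b c : V} {p q : List Ed} (hp : E.IsPath a p b)
    (hq : E.IsPath a' q c) (h : ¬ p <+: q) (h' : ¬ q <+: p) :
    ghostPath R E b p * path R E c q = 0 := by
  induction p generalizing a a' q with
  | nil => simp at h
  | cons e p ih =>
    cases q with
    | nil => simp at h'
    | cons f q =>
      rw [ghostPath, path, mul_assoc, ← mul_assoc (ghost R E e)]
      by_cases hef : e = f
      · subst hef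
        rw [(isLeavittFamily R E).ghost_edge, vertex_mul_path hq.2]
        exact ih hp.2 hq.2 (by simpa using h) (by simpa using h')
      · rw [(isLeavittFamily R E).ghost_edge_ne _ _ hef, zero_mul, mul_zero]

/-- Ideals are hereditary on vertices. -/
theorem vertex_mem_of_reaches {I : TwoSidedIdeal (LeavittPathAlgebra R E)} {a b : V}
    (h : E.Reaches a b) (ha : vertex R E a ∈ I) : vertex R E b ∈ I := by
  obtain ⟨p, hp⟩ := h
  have := I.mul_mem_right _ (path R E b p) (I.mul_mem_left (ghostPath R E b p) _ ha)
  rwa [ghostPath_mul_vertex hp, ghostPath_mul_path_self hp] at this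

end LeavittPathAlgebra

/-! ### The filtration by ghost length and the reduction theorem -/

namespace LeavittPathAlgebra

variable {R : Type w} [CommRing R] {V : Type u} {Ed : Type v} {E : DirectedGraph V Ed}

@[elab_as_elim]
theorem induction {C : LeavittPathAlgebra R E → Prop} (zero : C 0)
    (hv : ∀ x, C (vertex R E x)) (he : ∀ e, C (edge R E e)) (hg : ∀ e, C (ghost R E e))
    (add : ∀ a b, C a → C b → C (a + b)) (smul : ∀ (t : R) a, C a → C (t • a))
    (mul : ∀ a b, C a → C b → C (a * b)) (a : LeavittPathAlgebra R E) : C a := by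
  obtain ⟨f, rfl⟩ := mk_surjective R E a
  have hof : ∀ x, C (mk R E (Free.of R x)) := by
    rintro (x | e | e)
    exacts [hv x, he e, hg e]
  have hword : ∀ y : FreeSemigroup (Gen V Ed), C (mk R E (MonoidAlgebra.single y 1)) := by
    intro y
    induction y using FreeSemigroup.recOnMul with
    | ih1 x => exact hof x
    | ih2 x y _ ih =>
      have := mul _ _ (hof x) ih
      rwa [← mk_mul, Free.of, MonoidAlgebra.single_mul_single, one_mul] at this
  induction f using MonoidAlgebra.induction_linear with
  | zero => exact zero
  | add f g hf hg => rw [mk_add]; exact add _ _ hf hg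
  | single y t =>
    have := smul t _ (hword y)
    rwa [← mk_smul, MonoidAlgebra.smul_single, smul_eq_mul, mul_one] at this

/-- Finite sums of vertices are local right units. Stability under enlarging `F` is built in so that
two elements can share one unit. -/
theorem exists_mul_sum_vertex (a : LeavittPathAlgebra R E) :
    ∃ F : Finset V, ∀ F' : Finset V, F ⊆ F' → a * ∑ x ∈ F', vertex R E x = a := by
  classical
  have key : ∀ (a : LeavittPathAlgebra R E) (x : V), a * vertex R E x = a →
      ∃ F : Finset V, ∀ F' : Finset V, F ⊆ F' → a * ∑ x ∈ F', vertex R E x = a := by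
    intro a x hx
    refine ⟨{x}, fun F' hF' => ?_⟩
    rw [Finset.mul_sum, Finset.sum_eq_single_of_mem x (by simpa using hF'), hx]
    intro y _ hy
    rw [← hx, mul_assoc, (isLeavittFamily R E).orth _ _ hy.symm, mul_zero]
  induction a using induction with
  | zero => exact ⟨∅, by simp⟩
  | hv x => exact key _ x (vertex_mul_self x)
  | he e => exact key _ _ ((isLeavittFamily R E).edge_range e)
  | hg e => exact key _ _ ((isLeavittFamily R E).ghost_source e)
  | add a b ha hb =>
    obtain ⟨F, hF⟩ := ha
    obtain ⟨G, hG⟩ := hb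
    refine ⟨F ∪ G, fun F' hF' => ?_⟩
    rw [add_mul, hF _ (Finset.union_subset_left hF'), hG _ (Finset.union_subset_right hF')]
  | smul t a ha =>
    obtain ⟨F, hF⟩ := ha
    exact ⟨F, fun F' hF' => by rw [smul_mul_assoc, hF _ hF']⟩
  | mul a b ha hb =>
    obtain ⟨F, hF⟩ := hb
    exact ⟨F, fun F' hF' => by rw [mul_assoc, hF _ hF']⟩

theorem exists_mul_vertex_ne_zero {a : LeavittPathAlgebra R E} (ha : a ≠ 0) :
    ∃ x, a * vertex R E x ≠ 0 := by
  by_contra! h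
  obtain ⟨F, hF⟩ := exists_mul_sum_vertex a
  apply ha
  rw [← hF F subset_rfl, Finset.mul_sum, Finset.sum_eq_zero fun x _ => h x]

variable (R E) in
/-- The linear span of the real paths. -/
noncomputable def pathSpan : Submodule R (LeavittPathAlgebra R E) :=
  Submodule.span R (Set.range fun z : V × List Ed => path R E z.1 z.2)

variable (R E) in
/-- The linear span of the products `p q*` of paths with `q` of length at most `n`. -/
noncomputable def ghostDegreeLE : ℕ → Submodule R (LeavittPathAlgebra R E)
  | 0 => pathSpan R E
  | n + 1 => pathSpan R E ⊔ ⨆ e, (ghostDegreeLE n).map (LinearMap.mulRight R (ghost R E e))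

theorem path_mem_pathSpan (x : V) (p : List Ed) : path R E x p ∈ pathSpan R E :=
  Submodule.subset_span ⟨(x, p), rfl⟩

theorem mul_vertex_mem_pathSpan {a : LeavittPathAlgebra R E} (ha : a ∈ pathSpan R E) (x : V) :
    a * vertex R E x ∈ Submodule.span R (path R E x '' {p | ∃ y, E.IsPath y p x}) := by
  refine Submodule.span_induction (p := fun a _ => a * vertex R E x ∈ _) ?_ ?_ ?_ ?_ ha
  · rintro _ ⟨⟨y, p⟩, rfl⟩
    by_cases h : y = x
    · subst h
      rw [path_mul_vertex]
      rcases path_eq_zero_or_isPath (R := R) (E := E) y p with h | h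
      · rw [h]; exact zero_mem _
      · exact Submodule.subset_span ⟨p, h, rfl⟩
    · rw [path_mul_vertex_of_ne h]; exact zero_mem _
  · rw [zero_mul]; exact zero_mem _
  · intro a b _ _ ha hb
    rw [add_mul]; exact add_mem ha hb
  · intro t a _ ha
    rw [smul_mul_assoc]; exact Submodule.smul_mem _ t ha

theorem mul_vertex_mem_pathSpan' {a : LeavittPathAlgebra R E} (ha : a ∈ pathSpan R E) (x : V) :
    a * vertex R E x ∈ pathSpan R E :=
  Submodule.span_mono (by rintro _ ⟨p, -, rfl⟩; exact ⟨(x, p), rfl⟩) (mul_vertex_mem_pathSpan ha x)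

theorem mul_edge_mem_pathSpan {a : LeavittPathAlgebra R E} (ha : a ∈ pathSpan R E) (e : Ed) :
    a * edge R E e ∈ pathSpan R E := by
  refine Submodule.span_induction (p := fun a _ => a * edge R E e ∈ _) ?_ ?_ ?_ ?_ ha
  · rintro _ ⟨⟨y, p⟩, rfl⟩
    by_cases h : y = E.s e
    · subst h
      rw [path_mul_edge]
      exact path_mem_pathSpan _ _
    · rw [path_mul_edge_of_ne h]; exact zero_mem _
  · rw [zero_mul]; exact zero_mem _
  · intro a b _ _ ha hb
    rw [add_mul]; exact add_mem ha hb
  · intro t a _ ha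
    rw [smul_mul_assoc]; exact Submodule.smul_mem _ t ha

theorem pathSpan_le_ghostDegreeLE (n : ℕ) : pathSpan R E ≤ ghostDegreeLE R E n := by
  cases n with
  | zero => exact le_rfl
  | succ n => exact le_sup_left

theorem mul_ghost_mem {n : ℕ} {a : LeavittPathAlgebra R E} (ha : a ∈ ghostDegreeLE R E n)
    (e : Ed) : a * ghost R E e ∈ ghostDegreeLE R E (n + 1) :=
  Submodule.mem_sup_right (Submodule.mem_iSup_of_mem e ⟨a, ha, rfl⟩)

theorem exists_eq_add_sum {n : ℕ} {a : LeavittPathAlgebra R E}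
    (ha : a ∈ ghostDegreeLE R E (n + 1)) :
    ∃ b ∈ pathSpan R E, ∃ (F : Finset Ed) (c : Ed → LeavittPathAlgebra R E),
      (∀ e, c e ∈ ghostDegreeLE R E n) ∧ a = b + ∑ e ∈ F, c e * ghost R E e := by
  obtain ⟨b, hb, d, hd, rfl⟩ := Submodule.mem_sup.1 ha
  obtain ⟨f, hf, rfl⟩ := (Submodule.mem_iSup_iff_exists_finsupp _ _).1 hd
  choose c hc hcf using hf
  refine ⟨b, hb, f.support, c, hc, ?_⟩
  congr 1
  exact Finset.sum_congr rfl fun e _ => (hcf e).symm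

theorem ghostDegreeLE_mono : Monotone (ghostDegreeLE R E) := by
  refine monotone_nat_of_le_succ fun n => ?_
  induction n with
  | zero => exact le_sup_left
  | succ n ih => exact sup_le_sup_left (iSup_mono fun e => Submodule.map_mono ih) _

theorem mul_vertex_mem {n : ℕ} {a : LeavittPathAlgebra R E} (ha : a ∈ ghostDegreeLE R E n)
    (x : V) : a * vertex R E x ∈ ghostDegreeLE R E n := by
  cases n with
  | zero => exact mul_vertex_mem_pathSpan' ha x
  | succ n =>
    obtain ⟨b, hb, F, c, hc, rfl⟩ := exists_eq_add_sum ha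
    rw [add_mul, Finset.sum_mul]
    refine add_mem (pathSpan_le_ghostDegreeLE _ (mul_vertex_mem_pathSpan' hb x))
      (sum_mem fun e _ => ?_)
    rw [mul_assoc]
    by_cases h : E.s e = x
    · rw [← h, (isLeavittFamily R E).ghost_source]
      exact mul_ghost_mem (hc e) e
    · rw [← (isLeavittFamily R E).ghost_source, mul_assoc, (isLeavittFamily R E).orth _ _ h,
        mul_zero, mul_zero]
      exact zero_mem _

/-- The relation `f* e = δ r(e)` absorbs the last ghost edge, so right multiplication by an edge
lowers the filtration by one. This drives the induction in the reduction theorem. -/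
theorem mul_edge_mem {n : ℕ} {a : LeavittPathAlgebra R E}
    (ha : a ∈ ghostDegreeLE R E (n + 1)) (e : Ed) : a * edge R E e ∈ ghostDegreeLE R E n := by
  obtain ⟨b, hb, F, c, hc, rfl⟩ := exists_eq_add_sum ha
  rw [add_mul, Finset.sum_mul]
  refine add_mem (pathSpan_le_ghostDegreeLE _ (mul_edge_mem_pathSpan hb e))
    (sum_mem fun f _ => ?_)
  rw [mul_assoc]
  by_cases h : f = e
  · rw [h, (isLeavittFamily R E).ghost_edge]
    exact mul_vertex_mem (hc e) _
  · rw [(isLeavittFamily R E).ghost_edge_ne _ _ h, mul_zero]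
    exact zero_mem _

theorem exists_mem_ghostDegreeLE (a : LeavittPathAlgebra R E) :
    ∃ n, a ∈ ghostDegreeLE R E n := by
  -- Closure of the filtration under right multiplication by `a` is proved along with membership,
  -- since the product case of the induction needs it.
  suffices h : (∃ n, a ∈ ghostDegreeLE R E n) ∧
      ∀ b n, b ∈ ghostDegreeLE R E n → ∃ m, b * a ∈ ghostDegreeLE R E m from h.1
  have hadd : ∀ a b : LeavittPathAlgebra R E, (∃ n, a ∈ ghostDegreeLE R E n) →
      (∃ n, b ∈ ghostDegreeLE R E n) → ∃ n, a + b ∈ ghostDegreeLE R E n := by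
    rintro a b ⟨n, hn⟩ ⟨m, hm⟩
    exact ⟨max n m, add_mem (ghostDegreeLE_mono (le_max_left _ _) hn)
      (ghostDegreeLE_mono (le_max_right _ _) hm)⟩
  induction a using induction with
  | zero => exact ⟨⟨0, zero_mem _⟩, fun b n _ => ⟨0, by rw [mul_zero]; exact zero_mem _⟩⟩
  | hv x => exact ⟨⟨0, path_mem_pathSpan x []⟩, fun b n hb => ⟨n, mul_vertex_mem hb x⟩⟩
  | he e =>
    refine ⟨⟨0, ?_⟩, fun b n hb => ⟨n, mul_edge_mem (ghostDegreeLE_mono n.le_succ hb) e⟩⟩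
    rw [← (isLeavittFamily R E).edge_range]
    exact path_mem_pathSpan (E.r e) [e]
  | hg e =>
    refine ⟨⟨1, ?_⟩, fun b n hb => ⟨n + 1, mul_ghost_mem hb e⟩⟩
    rw [← (isLeavittFamily R E).range_ghost]
    exact mul_ghost_mem (path_mem_pathSpan (E.r e) []) e
  | add a b ha hb =>
    refine ⟨hadd _ _ ha.1 hb.1, fun c n hc => ?_⟩
    rw [mul_add]
    exact hadd _ _ (ha.2 c n hc) (hb.2 c n hc)
  | smul t a ha =>
    refine ⟨ha.1.imp fun n hn => Submodule.smul_mem _ t hn, fun c n hc => ?_⟩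
    rw [mul_smul_comm]
    exact (ha.2 c n hc).imp fun m hm => Submodule.smul_mem _ t hm
  | mul a b ha hb =>
    obtain ⟨⟨n, hn⟩, ha⟩ := ha
    refine ⟨hb.2 a n hn, fun c m hc => ?_⟩
    obtain ⟨k, hk⟩ := ha c m hc
    rw [← mul_assoc]
    exact hb.2 _ k hk

/-- A nonzero combination of real paths with range `x` is taken, by a left multiplication, to a
nonzero multiple of `x` plus a combination of closed paths of positive length. -/
theorem exists_mul_eq_smul_vertex_add {a : LeavittPathAlgebra R E} (ha : a ∈ pathSpan R E) {x : V}
    (hx : a * vertex R E x ≠ 0) :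
    ∃ (c : LeavittPathAlgebra R E) (t : R) (S : Finset (List Ed)),
      t ≠ 0 ∧ (∀ q ∈ S, E.IsPath x q x ∧ q ≠ []) ∧
        ∃ z ∈ Submodule.span R (path R E x '' S),
          c * (a * vertex R E x) = t • vertex R E x + z := by
  classical
  obtain ⟨l, hl, hlx⟩ := (Finsupp.mem_span_image_iff_linearCombination R).1
    (mul_vertex_mem_pathSpan ha x)
  rw [Finsupp.linearCombination_apply, Finsupp.sum] at hlx
  have hne : l.support.Nonempty := by
    rw [Finset.nonempty_iff_ne_empty]
    rintro h
    rw [h, Finset.sum_empty] at hlx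
    exact hx hlx.symm
  -- With `p` of minimal length, no other `q` in the support is a prefix of `p`; so `p* q` is zero
  -- or the remainder of `q` after `p`.
  obtain ⟨p, hp, hmin⟩ := l.support.exists_min_image List.length hne
  have hpath : ∀ q ∈ l.support, ∃ y, E.IsPath y q x := fun q hq =>
    (Finsupp.mem_supported R l).1 hl hq
  obtain ⟨y, hy⟩ := hpath p hp
  refine ⟨ghostPath R E x p, l p,
    ((l.support.erase p).filter fun q => p <+: q ∧ E.IsPath x (q.drop p.length) x).image
      (List.drop p.length), Finsupp.mem_support_iff.1 hp, ?_,
    ∑ q ∈ l.support.erase p, l q • (ghostPath R E x p * path R E x q), ?_, ?_⟩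
  · intro q hq
    simp only [Finset.mem_image, Finset.mem_filter, Finset.mem_erase] at hq
    obtain ⟨_, ⟨⟨hq, -⟩, ⟨q, rfl⟩, h⟩, rfl⟩ := hq
    refine ⟨h, ?_⟩
    rw [List.drop_left]
    rintro rfl
    simp at hq
  · refine sum_mem fun q hq => Submodule.smul_mem _ _ ?_
    obtain ⟨hqp, hq'⟩ := Finset.mem_erase.1 hq
    obtain ⟨y', hy'⟩ := hpath q hq'
    by_cases h : p <+: q
    · obtain ⟨q, rfl⟩ := h
      obtain ⟨b, h₁, h₂⟩ := DirectedGraph.isPath_append.1 hy'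
      by_cases hb : b = x
      · subst hb
        rw [ghostPath_mul_path_append h₁ h₂]
        refine Submodule.subset_span ⟨q, ?_, rfl⟩
        rw [Finset.mem_coe, Finset.mem_image]
        refine ⟨p ++ q, Finset.mem_filter.2 ⟨hq, List.prefix_append _ _, ?_⟩, List.drop_left⟩
        rwa [List.drop_left]
      -- The remainder can start elsewhere than at `x` only if `p` is empty; then `p*` is the vertex
      -- `x`, which annihilates it.
      · cases p with
        | nil =>
          rw [ghostPath, List.nil_append, vertex_mul_path_of_ne h₂ (Ne.symm hb)]
          exact zero_mem _
        | cons e p => exact absurd (h₁.2.range_unique hy.2) hb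
    · rw [ghostPath_mul_path_of_not_prefix hy hy' h fun h' =>
        hqp (h'.eq_of_length (le_antisymm h'.length_le (hmin q hq')))]
      exact zero_mem _
  · rw [← hlx, Finset.mul_sum, ← Finset.add_sum_erase _ _ hp, mul_smul_comm,
      ghostPath_mul_path_self hy]
    simp only [mul_smul_comm]

/-- Conjugation by a path `p` that avoids every `q p` annihilates the closed paths in `t • x + z`
and turns `t • x` into `t` times the range of `p`. -/
theorem exists_mul_mul_eq_smul_vertex_of_mem_pathSpan (hL : E.ConditionL)
    {a : LeavittPathAlgebra R E} (ha : a ∈ pathSpan R E) {x : V} (hx : a * vertex R E x ≠ 0) :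
    ∃ (c d : LeavittPathAlgebra R E) (t : R) (y : V), t ≠ 0 ∧
      c * (a * vertex R E x) * d = t • vertex R E y := by
  obtain ⟨c, t, S, ht, hS, z, hz, h⟩ := exists_mul_eq_smul_vertex_add ha hx
  obtain ⟨p, y, hp, hpS⟩ := hL.exists_isPath_not_prefix S hS
  refine ⟨ghostPath R E y p * c, path R E y p, t, y, ht, ?_⟩
  have hz' : ghostPath R E y p * z * path R E y p = 0 := by
    refine Submodule.span_induction
      (p := fun z _ => ghostPath R E y p * z * path R E y p = 0) ?_ ?_ ?_ ?_ hz
    · rintro _ ⟨q, hq, rfl⟩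
      rw [mul_assoc, path_mul_path hp]
      refine ghostPath_mul_path_of_not_prefix hp ((hS q hq).1.append hp) (hpS q hq) fun h => ?_
      have h₁ := h.length_le
      have h₂ := List.length_pos_of_ne_nil (hS q hq).2
      rw [List.length_append] at h₁
      omega
    · rw [mul_zero, zero_mul]
    · intro a b _ _ ha hb
      rw [mul_add, add_mul, ha, hb, add_zero]
    · intro t a _ ha
      rw [mul_smul_comm, smul_mul_assoc, ha, smul_zero]
  rw [mul_assoc (ghostPath R E y p) c, h, mul_add, add_mul, hz', add_zero, mul_smul_comm,
    smul_mul_assoc, ghostPath_mul_vertex hp, ghostPath_mul_path_self hp]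

theorem ghost_mul_path_of_head_ne {x y : V} {f : Ed} {q : List Ed} (hq : E.IsPath y q x)
    (hne : q ≠ []) (h : ∀ e ∈ q.head?, e ≠ f) : ghost R E f * path R E x q = 0 := by
  cases q with
  | nil => exact absurd rfl hne
  | cons e q =>
    rw [path, ← mul_assoc, (isLeavittFamily R E).ghost_edge_ne _ _ (h e rfl).symm, zero_mul]

/-- The reduction theorem: under Condition (L), every nonzero element of `L_R(E)` is taken by a
two-sided multiplication to a nonzero multiple of a vertex. -/
theorem exists_mul_mul_eq_smul_vertex (hL : E.ConditionL) {a : LeavittPathAlgebra R E}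
    (ha : a ≠ 0) :
    ∃ (c d : LeavittPathAlgebra R E) (t : R) (y : V), t ≠ 0 ∧ c * a * d = t • vertex R E y := by
  classical
  obtain ⟨n, hn⟩ := exists_mem_ghostDegreeLE a
  induction n generalizing a with
  | zero =>
    obtain ⟨x, hx⟩ := exists_mul_vertex_ne_zero ha
    obtain ⟨c, d, t, y, ht, h⟩ := exists_mul_mul_eq_smul_vertex_of_mem_pathSpan hL hn hx
    exact ⟨c, vertex R E x * d, t, y, ht, by rw [← h]; simp only [mul_assoc]⟩
  | succ n ih =>
    obtain ⟨x, hx⟩ := exists_mul_vertex_ne_zero ha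
    -- If some `a * e` is nonzero, it has lower ghost length. Otherwise every edge leaving `x` is
    -- annihilated by `a`, and the form `a = b + ∑ c e * e*` is analysed directly.
    by_cases hex : ∃ e, E.s e = x ∧ a * edge R E e ≠ 0
    · obtain ⟨e, -, he⟩ := hex
      obtain ⟨c, d, t, y, ht, h⟩ := ih he (mul_edge_mem hn e)
      exact ⟨c, edge R E e * d, t, y, ht, by rw [← h]; simp only [mul_assoc]⟩
    push Not at hex
    obtain ⟨b, hb, F, c, -, rfl⟩ := exists_eq_add_sum hn
    have hghost : ∀ e, E.s e ≠ x → ghost R E e * vertex R E x = 0 := fun e he => by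
      rw [← (isLeavittFamily R E).ghost_source, mul_assoc, (isLeavittFamily R E).orth _ _ he,
        mul_zero]
    have hedge : ∀ f, E.s f = x → f ∉ F → b * edge R E f = 0 := by
      intro f hf hfF
      rw [← hex f hf, add_mul, Finset.sum_mul, Finset.sum_eq_zero, add_zero]
      intro e he
      rw [mul_assoc, (isLeavittFamily R E).ghost_edge_ne _ _ (by rintro rfl; exact hfF he),
        mul_zero]
    -- If `b * x = 0`, then `0 = a * e = c e * r(e)` for each `e` in `F` leaving `x`. Thus `c e * e*
    -- = 0`, and `a * x` would vanish.
    by_cases hbx : b * vertex R E x = 0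
    · refine absurd ?_ hx
      rw [add_mul, hbx, zero_add, Finset.sum_mul]
      refine Finset.sum_eq_zero fun e he => ?_
      by_cases hs : E.s e = x
      · have h := hex e hs
        rw [add_mul, Finset.sum_mul, ← (isLeavittFamily R E).source_edge, hs, ← mul_assoc, hbx,
          zero_mul, zero_add, Finset.sum_eq_single_of_mem e he, ← mul_assoc, mul_assoc (c e),
          ← hs, (isLeavittFamily R E).ghost_source, mul_assoc,
          (isLeavittFamily R E).ghost_edge] at h
        · rw [← (isLeavittFamily R E).range_ghost, ← mul_assoc, h, zero_mul, zero_mul]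
        · intro f _ hf
          rw [← hs, (isLeavittFamily R E).source_edge, mul_assoc,
            (isLeavittFamily R E).ghost_edge_ne _ _ hf, mul_zero]
      · rw [mul_assoc, hghost e hs, mul_zero]
    by_cases hsink : ∃ e, E.s e = x
    · by_cases hfin : {e | E.s e = x}.Finite
      · refine absurd ?_ hx
        obtain ⟨e₀, he₀⟩ := hsink
        rw [(isLeavittFamily R E).sum_edge_ghost x hfin.toFinset ⟨e₀, by simpa using he₀⟩
          (by simp), Finset.mul_sum]
        refine Finset.sum_eq_zero fun e he => ?_
        rw [← mul_assoc, hex e (by simpa using he), zero_mul]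
      · obtain ⟨c', t, S, ht, hS, z, hz, h⟩ := exists_mul_eq_smul_vertex_add hb hbx
        -- At an infinite emitter, choose `f` outside `F`, so `b * f = a * f = 0`, and different
        -- from the first edge of every path in `S`, so `f* z = 0`.
        obtain ⟨f, hf, hfF⟩ := Set.Infinite.exists_notMem_finset hfin
          (F ∪ S.biUnion fun q => q.head?.toFinset)
        rw [Finset.notMem_union] at hfF
        -- Multiplying `c' * (b * x) = t • x + z` by `f*` and `f` gives `0 = t • r(f)`. Zero
        -- multipliers therefore suffice, without first knowing that nonzero multiples of vertices
        -- are nonzero.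
        refine ⟨0, 0, t, E.r f, ht, ?_⟩
        have hz' : ghost R E f * z = 0 := by
          refine Submodule.span_induction (p := fun z _ => ghost R E f * z = 0) ?_ ?_ ?_ ?_ hz
          · rintro _ ⟨q, hq, rfl⟩
            refine ghost_mul_path_of_head_ne (hS q hq).1 (hS q hq).2 ?_
            rintro e he rfl
            exact hfF.2 (Finset.mem_biUnion.2 ⟨q, hq, Option.mem_toFinset.2 he⟩)
          · rw [mul_zero]
          · intro a b _ _ ha hb
            rw [mul_add, ha, hb, add_zero]
          · intro t a _ ha
            rw [mul_smul_comm, ha, smul_zero]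
        have h' := congrArg (fun z => ghost R E f * z * edge R E f) h
        replace hf : E.s f = x := hf
        rw [mul_zero, ← (isLeavittFamily R E).ghost_edge]
        simp only [mul_add, hz', add_zero] at h'
        rw [mul_smul_comm, ← hf, (isLeavittFamily R E).ghost_source, smul_mul_assoc] at h'
        rw [← h']
        simp only [mul_assoc]
        rw [(isLeavittFamily R E).source_edge, hedge f hf hfF.1]
        simp
    · push Not at hsink
      -- At a sink every `e* x` is zero, so `a * x = b * x` is already a combination of real paths.
      obtain ⟨c', d, t, y, ht, h⟩ := exists_mul_mul_eq_smul_vertex_of_mem_pathSpan hL hb hbx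
      refine ⟨c', vertex R E x * d, t, y, ht, ?_⟩
      rw [← h, mul_assoc, ← mul_assoc _ (vertex R E x) d, add_mul, Finset.sum_mul,
        Finset.sum_eq_zero fun e _ => by rw [mul_assoc, hghost e (hsink e), mul_zero], add_zero]
      simp only [mul_assoc]

end LeavittPathAlgebra

/-! ### Branching systems and their representations -/

/-- A branching system for `E`: partial bijections `shift e` from a part of the set of the source
of `e` onto the set of the range of `e`, whose domains are disjoint and cover the sets of the regular
vertices. -/
structure BranchingSystem {V : Type u} {Ed : Type v} (E : DirectedGraph V Ed) (X : Type*) where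
  /-- the set belonging to a vertex -/
  carrier : V → Set X
  /-- the partial bijection belonging to an edge -/
  shift : Ed → X ≃. X
  disjoint : ∀ {u v x}, x ∈ carrier u → x ∈ carrier v → u = v
  source_mem : ∀ {e x y}, y ∈ shift e x → x ∈ carrier (E.s e)
  range_mem : ∀ {e x y}, y ∈ shift e x → y ∈ carrier (E.r e)
  exists_preimage : ∀ {e y}, y ∈ carrier (E.r e) → ∃ x, y ∈ shift e x
  shift_unique : ∀ {e e' x y y'}, y ∈ shift e x → y' ∈ shift e' x → e = e'
  exists_shift : ∀ {u x}, (∃ e, E.s e = u) → {e | E.s e = u}.Finite → x ∈ carrier u →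
    ∃ e y, y ∈ shift e x

namespace PEquiv

/-- The operator `g ↦ g ∘ f` on functions, extended by zero outside of the domain of `f`. -/
def funLeft (R : Type*) [CommRing R] {X : Type*} (f : X ≃. X) : Module.End R (X → R) where
  toFun g x := (f x).elim 0 g
  map_add' g h := by funext x; cases hx : f x <;> simp [hx]
  map_smul' t g := by funext x; cases hx : f x <;> simp [hx]

theorem funLeft_apply {R : Type*} [CommRing R] {X : Type*} (f : X ≃. X) (g : X → R) (x : X) :
    funLeft R f g x = (f x).elim 0 g := rfl

theorem funLeft_of_mem {R : Type*} [CommRing R] {X : Type*} {f : X ≃. X} {x y : X} (h : y ∈ f x)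
    (g : X → R) : funLeft R f g x = g y := by
  rw [funLeft_apply, Option.mem_def.1 h]; rfl

theorem funLeft_of_forall_notMem {R : Type*} [CommRing R] {X : Type*} {f : X ≃. X} {x : X}
    (h : ∀ y, y ∉ f x) (g : X → R) : funLeft R f g x = 0 := by
  rw [funLeft_apply, Option.eq_none_iff_forall_not_mem.2 h]; rfl

theorem funLeft_mul_apply {R : Type*} [CommRing R] {X : Type*} (f f' : X ≃. X) (g : X → R) :
    (funLeft R f * funLeft R f') g = funLeft R f (funLeft R f' g) := rfl

end PEquiv

namespace BranchingSystem

open Classical LeavittPathAlgebra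

variable {V : Type u} {Ed : Type v} {E : DirectedGraph V Ed} {X : Type*}
  (B : BranchingSystem E X) (R : Type w) [CommRing R]

theorem funLeft_ofSet {R : Type*} [CommRing R] {X : Type*} (s : Set X) (g : X → R) (x : X) :
    PEquiv.funLeft R (PEquiv.ofSet s) g x = if x ∈ s then g x else 0 := by
  split_ifs with h
  · exact PEquiv.funLeft_of_mem (PEquiv.mem_ofSet_self_iff.2 h) g
  · exact PEquiv.funLeft_of_forall_notMem (fun y hy => h (PEquiv.mem_ofSet_iff.1 hy).2) g

theorem funLeft_self_symm {R : Type*} [CommRing R] {X : Type*} (f : X ≃. X) (g : X → R) (x : X) :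
    PEquiv.funLeft R f (PEquiv.funLeft R f.symm g) x = if (f x).isSome then g x else 0 := by
  cases h : f x with
  | none =>
    rw [PEquiv.funLeft_of_forall_notMem (by simp [h])]; rfl
  | some y =>
    rw [PEquiv.funLeft_of_mem (Option.mem_def.2 h),
      PEquiv.funLeft_of_mem (f.mem_iff_mem.2 (Option.mem_def.2 h))]; rfl

/-- Disjoint domains give `e* f = 0` for distinct edges, surjectivity onto the set of the range
gives `e* e = r(e)`, and covering at regular vertices gives the sum relation. -/
theorem isLeavittFamily : IsLeavittFamily E
    (fun u => PEquiv.funLeft R (PEquiv.ofSet (B.carrier u)))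
    (fun e => PEquiv.funLeft R (B.shift e)) (fun e => PEquiv.funLeft R (B.shift e).symm) where
  idem u := by
    ext1 g; funext x
    rw [PEquiv.funLeft_mul_apply]
    simp only [funLeft_ofSet]
    split_ifs <;> rfl
  orth u v huv := by
    ext1 g; funext x
    rw [PEquiv.funLeft_mul_apply]
    simp only [funLeft_ofSet]
    split_ifs with h₁ h₂
    · exact absurd (B.disjoint h₁ h₂) huv
    all_goals rfl
  source_edge e := by
    ext1 g; funext x
    rw [PEquiv.funLeft_mul_apply, funLeft_ofSet]
    split_ifs with h
    · rfl
    · rw [PEquiv.funLeft_of_forall_notMem fun y hy => h (B.source_mem hy)]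
  edge_range e := by
    ext1 g; funext x
    rw [PEquiv.funLeft_mul_apply]
    cases h : B.shift e x with
    | none => simp [PEquiv.funLeft_apply, h]
    | some y =>
      rw [PEquiv.funLeft_of_mem h, PEquiv.funLeft_of_mem h, funLeft_ofSet,
        if_pos (B.range_mem h)]
  range_ghost e := by
    ext1 g; funext y
    rw [PEquiv.funLeft_mul_apply, funLeft_ofSet]
    split_ifs with h
    · rfl
    · rw [PEquiv.funLeft_of_forall_notMem fun x hx =>
        h (B.range_mem ((B.shift e).mem_iff_mem.1 hx))]
  ghost_source e := by
    ext1 g; funext y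
    rw [PEquiv.funLeft_mul_apply]
    cases h : (B.shift e).symm y with
    | none => simp [PEquiv.funLeft_apply, h]
    | some x =>
      rw [PEquiv.funLeft_of_mem h, PEquiv.funLeft_of_mem h, funLeft_ofSet,
        if_pos (B.source_mem ((B.shift e).mem_iff_mem.1 h))]
  ghost_edge e := by
    ext1 g; funext y
    rw [PEquiv.funLeft_mul_apply, funLeft_ofSet]
    split_ifs with h
    · obtain ⟨x, hx⟩ := B.exists_preimage h
      rw [PEquiv.funLeft_of_mem ((B.shift e).mem_iff_mem.2 hx), PEquiv.funLeft_of_mem hx]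
    · rw [PEquiv.funLeft_of_forall_notMem fun x hx =>
        h (B.range_mem ((B.shift e).mem_iff_mem.1 hx))]
  ghost_edge_ne e f hef := by
    ext1 g; funext y
    rw [PEquiv.funLeft_mul_apply]
    cases h : (B.shift e).symm y with
    | none => simp [PEquiv.funLeft_apply, h]
    | some x =>
      rw [PEquiv.funLeft_of_mem h, PEquiv.funLeft_of_forall_notMem fun z hz =>
        hef (B.shift_unique ((B.shift e).mem_iff_mem.1 h) hz)]
      rfl
  sum_edge_ghost u F hF hFu := by
    ext1 g; funext x
    rw [funLeft_ofSet, LinearMap.sum_apply, Finset.sum_apply]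
    simp only [PEquiv.funLeft_mul_apply, funLeft_self_symm]
    split_ifs with h
    · obtain ⟨e₀, he₀⟩ := hF
      obtain ⟨e, y, hy⟩ := B.exists_shift ⟨e₀, (hFu e₀).1 he₀⟩
        (F.finite_toSet.subset fun e he => (hFu e).2 he) h
      rw [Finset.sum_eq_single_of_mem e ((hFu e).2 (B.disjoint (B.source_mem hy) h)),
        if_pos (Option.isSome_iff_exists.2 ⟨y, hy⟩)]
      intro f _ hf
      refine if_neg fun h' => ?_
      obtain ⟨z, hz⟩ := Option.isSome_iff_exists.1 h'
      exact hf (B.shift_unique hz hy)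
    · refine (Finset.sum_eq_zero fun e he => if_neg fun h' => h ?_).symm
      obtain ⟨z, hz⟩ := Option.isSome_iff_exists.1 h'
      exact (hFu e).1 he ▸ B.source_mem hz

/-- The representation of `L_R(E)` on functions that is given by a branching system. -/
noncomputable def rep : LeavittPathAlgebra R E →ₙₐ[R] Module.End R (X → R) :=
  (existsUnique_lift (B.isLeavittFamily R)).choose

theorem rep_vertex (u : V) :
    B.rep R (vertex R E u) = PEquiv.funLeft R (PEquiv.ofSet (B.carrier u)) :=
  (existsUnique_lift (B.isLeavittFamily R)).choose_spec.1.1 u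

theorem rep_edge (e : Ed) : B.rep R (edge R E e) = PEquiv.funLeft R (B.shift e) :=
  (existsUnique_lift (B.isLeavittFamily R)).choose_spec.1.2.1 e

theorem rep_ghost (e : Ed) : B.rep R (ghost R E e) = PEquiv.funLeft R (B.shift e).symm :=
  (existsUnique_lift (B.isLeavittFamily R)).choose_spec.1.2.2 e

theorem rep_vertex_apply (u : V) (g : X → R) (x : X) :
    B.rep R (vertex R E u) g x = if x ∈ B.carrier u then g x else 0 := by
  rw [rep_vertex, funLeft_ofSet]

/-- The kernel of the representation. -/
noncomputable def ker : TwoSidedIdeal (LeavittPathAlgebra R E) := TwoSidedIdeal.ker (B.rep R)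

theorem mem_ker {a : LeavittPathAlgebra R E} : a ∈ B.ker R ↔ B.rep R a = 0 :=
  TwoSidedIdeal.mem_ker _

theorem smul_vertex_notMem_ker {u : V} (h : (B.carrier u).Nonempty) {t : R} (ht : t ≠ 0) :
    t • vertex R E u ∉ B.ker R := by
  obtain ⟨x, hx⟩ := h
  intro h
  rw [mem_ker, map_smul] at h
  have h' := congrFun (LinearMap.congr_fun h 1) x
  rw [LinearMap.smul_apply, Pi.smul_apply, rep_vertex_apply, if_pos hx] at h'
  exact ht (by simpa using h')

theorem vertex_mem_ker {u : V} (h : B.carrier u = ∅) : vertex R E u ∈ B.ker R := by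
  rw [mem_ker]
  ext1 g; funext x
  rw [rep_vertex_apply, if_neg (by simp [h])]
  rfl

theorem rep_vertex_sub_apply (u : V) (F : Finset Ed) (g : X → R) (x : X) :
    B.rep R (vertex R E u - ∑ e ∈ F, edge R E e * ghost R E e) g x =
      (if x ∈ B.carrier u then g x else 0) -
        ∑ e ∈ F, if (B.shift e x).isSome then g x else 0 := by
  rw [map_sub, map_sum, LinearMap.sub_apply, Pi.sub_apply, rep_vertex_apply, LinearMap.sum_apply,
    Finset.sum_apply]
  simp only [map_mul, rep_edge, rep_ghost, PEquiv.funLeft_mul_apply, funLeft_self_symm]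

/-- The element `v - ∑ e e*` acts as multiplication by the indicator of the set of `v` minus the
domains of the edges in `F`. If `t ≠ 0` times it annihilates the constant function `1`, that set is
empty. -/
theorem isBasic_ker : IsBasic (B.ker R) := by
  intro t u F ht hF h
  have hF' : ∀ {e x}, e ∈ F → (B.shift e x).isSome → x ∈ B.carrier u := fun {e x} he hx => by
    obtain ⟨y, hy⟩ := Option.isSome_iff_exists.1 hx
    exact hF e he ▸ B.source_mem hy
  rw [mem_ker] at h ⊢
  rw [map_smul] at h
  ext1 g; funext x
  rw [rep_vertex_sub_apply]
  change _ = (0 : R)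
  by_cases hx : ∃ e ∈ F, (B.shift e x).isSome
  · obtain ⟨e, he, hex⟩ := hx
    rw [if_pos (hF' he hex), Finset.sum_eq_single_of_mem e he, if_pos hex, sub_self]
    intro f _ hf
    refine if_neg fun hfx => hf ?_
    obtain ⟨y, hy⟩ := Option.isSome_iff_exists.1 hex
    obtain ⟨z, hz⟩ := Option.isSome_iff_exists.1 hfx
    exact B.shift_unique hz hy
  · push Not at hx
    rw [Finset.sum_eq_zero fun e he => if_neg (hx e he), sub_zero]
    refine if_neg fun hxu => ht ?_
    have h' := congrFun (LinearMap.congr_fun h 1) x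
    rw [LinearMap.smul_apply, Pi.smul_apply, rep_vertex_sub_apply, if_pos hxu,
      Finset.sum_eq_zero fun e he => if_neg (hx e he), sub_zero] at h'
    simpa using h'

end BranchingSystem

/-! ### Partial bijections from relations, and labellings of edges -/

open Classical in
/-- The element that satisfies a predicate, if there is one. -/
noncomputable def Option.ofPred {α : Type*} (p : α → Prop) : Option α :=
  if h : ∃ a, p a then some h.choose else none

theorem Option.mem_ofPred {α : Type*} {p : α → Prop} (hp : ∀ {a b}, p a → p b → a = b) {a : α} :
    a ∈ Option.ofPred p ↔ p a := by
  unfold Option.ofPred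
  split_ifs with h
  · rw [Option.mem_some_iff]
    exact ⟨fun h' => h' ▸ h.choose_spec, fun h' => hp h.choose_spec h'⟩
  · simpa using fun h' => h ⟨a, h'⟩

/-- The partial bijection whose graph is a functional and injective relation. -/
noncomputable def PEquiv.ofRel {α β : Type*} (r : α → β → Prop)
    (hr : ∀ ⦃a b b'⦄, r a b → r a b' → b = b') (hr' : ∀ ⦃a a' b⦄, r a b → r a' b → a = a') :
    α ≃. β where
  toFun a := Option.ofPred (r a)
  invFun b := Option.ofPred fun a => r a b
  inv _ _ := (Option.mem_ofPred @fun _ _ h h' => hr' h h').trans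
    (Option.mem_ofPred @fun _ _ h h' => hr h h').symm

theorem PEquiv.mem_ofRel {α β : Type*} {r : α → β → Prop}
    {hr : ∀ ⦃a b b'⦄, r a b → r a b' → b = b'} {hr' : ∀ ⦃a a' b⦄, r a b → r a' b → a = a'}
    {a : α} {b : β} : b ∈ PEquiv.ofRel r hr hr' a ↔ r a b :=
  Option.mem_ofPred @fun _ _ h h' => hr h h'

/-- A partition of `ℕ` into copies of `ℕ`, indexed by a countable set. -/
theorem Set.exists_labelling {α : Type*} [Countable α] (S : Set α) :
    ∃ l : α → ℕ → ℕ, (∀ a ∈ S, ∀ b ∈ S, ∀ m n, l a m = l b n → a = b ∧ m = n) ∧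
      (S.Nonempty → ∀ n, ∃ a ∈ S, ∃ m, l a m = n) ∧
      (S.Subsingleton → ∀ a n, l a n = n) := by
  classical
  by_cases hS : S.Subsingleton
  · exact ⟨fun _ n => n, fun a ha b hb m n h => ⟨hS ha hb, h⟩,
      fun ⟨a, ha⟩ n => ⟨a, ha, n, rfl⟩, fun _ _ _ => rfl⟩
  · obtain ⟨a₀, ha₀⟩ : S.Nonempty := by
      rw [Set.nonempty_iff_ne_empty]
      rintro rfl
      exact hS Set.subsingleton_empty
    have : Nonempty S := ⟨⟨a₀, ha₀⟩⟩
    obtain ⟨φ⟩ : Nonempty (S × ℕ ≃ ℕ) := nonempty_equiv_of_countable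
    refine ⟨fun a n => if h : a ∈ S then φ (⟨a, h⟩, n) else n, ?_, ?_, fun h => absurd h hS⟩
    · intro a ha b hb m n h
      simp only [dif_pos ha, dif_pos hb] at h
      simpa using φ.injective h
    · rintro - n
      refine ⟨(φ.symm n).1, (φ.symm n).1.2, (φ.symm n).2, ?_⟩
      simp

/-- At each vertex, the labels of the outgoing edges that avoid `H` partition `ℕ`, and so supply
disjoint covering domains for the shifts. The identity label at a single outgoing edge makes paths
without exits preserve the `ℕ` coordinate. -/
theorem DirectedGraph.exists_edge_labelling {V : Type u} {Ed : Type v} [Countable Ed]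
    (E : DirectedGraph V Ed) (H : Set V) :
    ∃ l : Ed → ℕ → ℕ,
      (∀ e f m n, E.r e ∉ H → E.r f ∉ H → E.s e = E.s f → l e m = l f n → e = f ∧ m = n) ∧
      (∀ u, (∃ e, E.s e = u ∧ E.r e ∉ H) → ∀ n, ∃ e m, E.s e = u ∧ E.r e ∉ H ∧ l e m = n) ∧
      (∀ e n, (∀ f, E.s f = E.s e → f = e) → l e n = n) := by
  choose l hl₁ hl₂ hl₃ using fun u => Set.exists_labelling {e | E.s e = u ∧ E.r e ∉ H}
  refine ⟨fun e => l (E.s e) e, ?_, ?_, ?_⟩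
  · intro e f m n he hf hs h
    refine hl₁ (E.s e) e ⟨rfl, he⟩ f ⟨hs.symm, hf⟩ m n ?_
    change l (E.s e) e m = l (E.s f) f n at h
    rwa [← hs] at h
  · intro u hu n
    obtain ⟨e, ⟨rfl, he⟩, m, hm⟩ := hl₂ u hu n
    exact ⟨e, m, rfl, he, hm⟩
  · intro e n h
    exact hl₃ _ (fun f hf g hg => (h f hf.1).trans (h g hg.1).symm) e n

/-! ### Graded branching systems on the complement of a saturated set -/

namespace BranchingSystem

variable {V : Type u} {Ed : Type v} [Countable Ed]

/-- The partial bijection of `V × ℕ × ℤ` that belongs to the edge `e`. -/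
noncomputable def gradedShift (E : DirectedGraph V Ed) (d : ℤ) (H : Set V) (e : Ed) :
    V × ℕ × ℤ ≃. V × ℕ × ℤ :=
  PEquiv.ofRel
    (fun x y => y.1 = E.r e ∧ E.r e ∉ H ∧
      x = (E.s e, (E.exists_edge_labelling H).choose e y.2.1, y.2.2 + d))
    (by
      rintro x ⟨_, m, i⟩ ⟨_, n, j⟩ ⟨rfl, h, rfl⟩ ⟨rfl, -, h'⟩
      simp only [Prod.mk.injEq, true_and, add_left_inj] at h'
      obtain ⟨h', rfl⟩ := h'
      obtain ⟨-, rfl⟩ := (E.exists_edge_labelling H).choose_spec.1 e e m n h h rfl h'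
      rfl)
    (by rintro x x' y ⟨-, -, rfl⟩ ⟨-, -, rfl⟩; rfl)

theorem mem_gradedShift {E : DirectedGraph V Ed} {d : ℤ} {H : Set V} {e : Ed}
    {x y : V × ℕ × ℤ} : y ∈ gradedShift E d H e x ↔ y.1 = E.r e ∧ E.r e ∉ H ∧
      x = (E.s e, (E.exists_edge_labelling H).choose e y.2.1, y.2.2 + d) :=
  PEquiv.mem_ofRel

/-- A branching system on `V × ℕ × ℤ` that vanishes on a hereditary and saturated set of vertices
and shifts the last coordinate by `d`. -/
noncomputable def graded (E : DirectedGraph V Ed) (d : ℤ) (H : Set V)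
    (hH : ∀ e, E.s e ∈ H → E.r e ∈ H)
    (hsat : ∀ u, (∃ e, E.s e = u) → (∀ e, E.s e = u → E.r e ∈ H) → u ∈ H) :
    BranchingSystem E (V × ℕ × ℤ) where
  carrier u := {x | x.1 = u ∧ u ∉ H}
  shift := gradedShift E d H
  disjoint h h' := h.1.symm.trans h'.1
  source_mem := by
    intro e x y h
    obtain ⟨-, he, rfl⟩ := mem_gradedShift.1 h
    exact ⟨rfl, fun h' => he (hH e h')⟩
  range_mem := by
    intro e x y h
    obtain ⟨hy, he, -⟩ := mem_gradedShift.1 h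
    exact ⟨hy, he⟩
  exists_preimage := fun h => ⟨_, mem_gradedShift.2 ⟨h.1, h.2, rfl⟩⟩
  shift_unique := by
    intro e e' x y y' h h'
    obtain ⟨-, h₁, rfl⟩ := mem_gradedShift.1 h
    obtain ⟨-, h₂, h⟩ := mem_gradedShift.1 h'
    simp only [Prod.mk.injEq] at h
    exact ((E.exists_edge_labelling H).choose_spec.1 e e' _ _ h₁ h₂ h.1 h.2.1).1
  exists_shift := by
    rintro _ ⟨u, n, k⟩ he - ⟨rfl, hu⟩
    -- Saturation is assumed at infinite emitters too, so the domains cover the set of every vertex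
    -- outside `H` that emits an edge.
    have he' : ∃ e, E.s e = u ∧ E.r e ∉ H := by
      by_contra! h
      exact hu (hsat u he h)
    obtain ⟨e, m, rfl, h, rfl⟩ := (E.exists_edge_labelling H).choose_spec.2.1 u he' n
    exact ⟨e, (E.r e, m, k - d), mem_gradedShift.2 ⟨rfl, h, by rw [sub_add_cancel]⟩⟩

variable {E : DirectedGraph V Ed} {d : ℤ} {H : Set V} {hH : ∀ e, E.s e ∈ H → E.r e ∈ H}
  {hsat : ∀ u, (∃ e, E.s e = u) → (∀ e, E.s e = u → E.r e ∈ H) → u ∈ H}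

theorem mem_graded_carrier {u : V} {x : V × ℕ × ℤ} :
    x ∈ (graded E d H hH hsat).carrier u ↔ x.1 = u ∧ u ∉ H :=
  Iff.rfl

theorem mem_graded_shift {e : Ed} (he : ∀ f, E.s f = E.s e → f = e) (h : E.r e ∉ H) (n : ℕ)
    (k : ℤ) : ((E.r e, n, k - d) : V × ℕ × ℤ) ∈ (graded E d H hH hsat).shift e (E.s e, n, k) := by
  refine mem_gradedShift.2 ⟨rfl, h, ?_⟩
  rw [(E.exists_edge_labelling H).choose_spec.2.2 e n he, sub_add_cancel]

theorem carrier_graded_nonempty {u : V} (hu : u ∉ H) :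
    ((graded E d H hH hsat).carrier u).Nonempty :=
  ⟨(u, 0, 0), mem_graded_carrier.2 ⟨rfl, hu⟩⟩

theorem carrier_graded_eq_empty {u : V} (hu : u ∈ H) :
    (graded E d H hH hsat).carrier u = ∅ :=
  Set.eq_empty_of_forall_notMem fun _ hx => (mem_graded_carrier.1 hx).2 hu

variable (R : Type w) [CommRing R]

/-- Each edge of a path without exits is the only one leaving its source, so its label is the
identity and it only moves the last coordinate by `d`. The length of the path is thus visible for `d
= 1` and invisible for `d = 0`. -/
theorem rep_graded_path_apply {hH : ∀ e, E.s e ∈ (∅ : Set V) → E.r e ∈ (∅ : Set V)}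
    {hsat : ∀ u, (∃ e, E.s e = u) → (∀ e, E.s e = u → E.r e ∈ (∅ : Set V)) → u ∈ (∅ : Set V)}
    {a b : V} {p : List Ed} (hp : E.IsPath a p b)
    (hex : ¬ E.HasExit p) (g : V × ℕ × ℤ → R) (n : ℕ) (k : ℤ) :
    (graded E d ∅ hH hsat).rep R (LeavittPathAlgebra.path R E b p) g (a, n, k) =
      g (b, n, k - p.length * d) := by
  induction p generalizing a k with
  | nil =>
    cases hp
    rw [LeavittPathAlgebra.path, rep_vertex_apply,
      if_pos (mem_graded_carrier (x := (b, n, k)).2 ⟨rfl, Set.notMem_empty _⟩)]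
    simp
  | cons e p ih =>
    obtain rfl : E.s e = a := hp.1
    have he : ∀ f, E.s f = E.s e → f = e := fun f hf => by
      by_contra h
      exact hex ⟨e, List.mem_cons_self, f, hf, h⟩
    rw [LeavittPathAlgebra.path, map_mul, rep_edge, Module.End.mul_apply,
      PEquiv.funLeft_of_mem (mem_graded_shift he (Set.notMem_empty _) n k),
      ih hp.2 fun ⟨e', he', h⟩ => hex ⟨e', List.mem_cons_of_mem _ he', h⟩]
    congr 3
    push_cast [List.length_cons]
    ring

end BranchingSystem

/-! ### Basic ideals and the graph conditions -/

namespace LeavittPathAlgebra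

variable {R : Type w} [CommRing R] {V : Type u} {Ed : Type v}  {E : DirectedGraph V Ed}

theorem exists_vertex_mem (hL : E.ConditionL) {I : TwoSidedIdeal (LeavittPathAlgebra R E)}
    (hI : I ≠ ⊥) (hb : IsBasic I) : ∃ x, vertex R E x ∈ I := by
  obtain ⟨a, ha, hne⟩ : ∃ a ∈ I, a ≠ 0 := by
    by_contra! h
    refine hI (TwoSidedIdeal.ext fun a => ?_)
    rw [TwoSidedIdeal.mem_bot]
    exact ⟨h a, fun h' => h' ▸ I.zero_mem⟩
  obtain ⟨c, d, t, y, ht, h⟩ := exists_mul_mul_eq_smul_vertex hL hne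
  refine ⟨y, ?_⟩
  have := hb t y ∅ ht (by simp)
    (by simpa [← h] using I.mul_mem_right _ d (I.mul_mem_left c _ ha))
  simpa using this

theorem vertex_mul_sub_sum (x : V) (F : Finset Ed) (hF : ∀ e ∈ F, E.s e = x) :
    vertex R E x * (vertex R E x - ∑ e ∈ F, edge R E e * ghost R E e) =
      vertex R E x - ∑ e ∈ F, edge R E e * ghost R E e := by
  rw [mul_sub, vertex_mul_self, Finset.mul_sum]
  congr 1
  refine Finset.sum_congr rfl fun e he => ?_
  rw [← mul_assoc, ← hF e he, (isLeavittFamily R E).source_edge]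

theorem isBasic_of_isField (hR : IsField R) (I : TwoSidedIdeal (LeavittPathAlgebra R E)) :
    IsBasic I := by
  intro t x F ht hF h
  obtain ⟨s, hs⟩ := hR.mul_inv_cancel ht
  have h' := I.mul_mem_left (s • vertex R E x) _ h
  rwa [smul_mul_assoc, mul_smul_comm, smul_smul, mul_comm, hs, one_smul,
    vertex_mul_sub_sum x F hF] at h'

variable (R E) in
/-- The ideal of the multiples of a scalar. -/
noncomputable def smulIdeal (t : R) : TwoSidedIdeal (LeavittPathAlgebra R E) :=
  .mk' {a | ∃ b : LeavittPathAlgebra R E, a = t • b} ⟨0, (smul_zero t).symm⟩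
    (by rintro _ _ ⟨a, rfl⟩ ⟨b, rfl⟩; exact ⟨a + b, (smul_add t a b).symm⟩)
    (by rintro _ ⟨a, rfl⟩; exact ⟨-a, (smul_neg t a).symm⟩)
    (by rintro a _ ⟨b, rfl⟩; exact ⟨a * b, mul_smul_comm t a b⟩)
    (by rintro _ b ⟨a, rfl⟩; exact ⟨a * b, smul_mul_assoc t a b⟩)

theorem mem_smulIdeal {t : R} {a : LeavittPathAlgebra R E} :
    a ∈ smulIdeal R E t ↔ ∃ b : LeavittPathAlgebra R E, a = t • b :=
  TwoSidedIdeal.mem_mk' _ _ _ _ _ _ _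

theorem exists_vertex_mem_inf (hL : E.ConditionL) (hM : E.ConditionMT3)
    {I J : TwoSidedIdeal (LeavittPathAlgebra R E)} (hI : I ≠ ⊥) (hJ : J ≠ ⊥) (hIb : IsBasic I)
    (hJb : IsBasic J) : ∃ x, vertex R E x ∈ I ∧ vertex R E x ∈ J := by
  obtain ⟨x, hx⟩ := exists_vertex_mem hL hI hIb
  obtain ⟨y, hy⟩ := exists_vertex_mem hL hJ hJb
  obtain ⟨z, hxz, hyz⟩ := hM x y
  exact ⟨z, vertex_mem_of_reaches hxz hx, vertex_mem_of_reaches hyz hy⟩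

variable [Countable Ed]

variable (E) in
/-- The branching system on all of `V × ℕ × ℤ` that shifts the last coordinate by `d`. -/
noncomputable def fullSystem (d : ℤ) : BranchingSystem E (V × ℕ × ℤ) :=
  .graded E d ∅ (fun _ h => h) fun _ ⟨e, he⟩ h => (h e he).elim

theorem mem_fullSystem_carrier {d : ℤ} {u : V} {x : V × ℕ × ℤ} :
    x ∈ (fullSystem E d).carrier u ↔ x.1 = u :=
  BranchingSystem.mem_graded_carrier.trans (and_iff_left (Set.notMem_empty u))

theorem smul_vertex_ne_zero {t : R} (ht : t ≠ 0) (x : V) : t • vertex R E x ≠ 0 := by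
  intro h
  apply (fullSystem E 0).smul_vertex_notMem_ker R
    (BranchingSystem.carrier_graded_nonempty (Set.notMem_empty x)) ht
  rw [h]
  exact TwoSidedIdeal.zero_mem _

theorem vertex_ne_zero [Nontrivial R] (x : V) : vertex R E x ≠ 0 := by
  simpa using smul_vertex_ne_zero (R := R) (E := E) one_ne_zero x

/-- Applying both sides to the constant function `1` and evaluating at a point belonging to `x`
gives an equation `1 = t * s` in `R`. -/
theorem isUnit_of_vertex_eq_smul {t : R} {x : V} {a : LeavittPathAlgebra R E}
    (h : vertex R E x = t • a) : IsUnit t := by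
  have h' := congrFun (LinearMap.congr_fun (congrArg ((fullSystem E 0).rep R) h) 1)
    (x, 0, 0)
  rw [map_smul, BranchingSystem.rep_vertex_apply,
    if_pos (mem_fullSystem_carrier (x := (x, 0, 0)).2 rfl)] at h'
  exact IsUnit.of_mul_eq_one _ h'.symm

/-- The ideal is the kernel for shift `d = 0`: it contains `a - q` for a closed path `q` at `a`
without exit, whereas every vertex acts nontrivially. -/
theorem exists_ne_bot_of_not_conditionL [Nontrivial R] (hL : ¬ E.ConditionL) :
    ∃ I : TwoSidedIdeal (LeavittPathAlgebra R E), I ≠ ⊥ ∧ IsBasic I ∧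
      ∀ x, vertex R E x ∉ I := by
  simp only [DirectedGraph.ConditionL, not_forall] at hL
  obtain ⟨q, hq, hex⟩ := hL
  obtain ⟨a, hpath, hne⟩ : ∃ a, E.IsPath a q a ∧ q ≠ [] := by
    match q, hq with
    | e :: p, hq => exact ⟨E.s e, hq.1, by simp⟩
  refine ⟨(fullSystem E 0).ker R, fun hbot => ?_, BranchingSystem.isBasic_ker _ R, fun x hx => ?_⟩
  · have hmem : vertex R E a - path R E a q ∈ (fullSystem E 0).ker R := by
      rw [BranchingSystem.mem_ker]
      ext1 g
      funext ⟨b, n, k⟩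
      rw [map_sub, ← vertex_mul_path hpath, map_mul, LinearMap.sub_apply, Pi.sub_apply,
        Module.End.mul_apply, BranchingSystem.rep_vertex_apply, BranchingSystem.rep_vertex_apply]
      split_ifs with h
      · obtain rfl : b = a := mem_fullSystem_carrier.1 h
        rw [fullSystem, BranchingSystem.rep_graded_path_apply R hpath hex]
        simp
      · simp
    rw [hbot] at hmem
    have hzero : vertex R E a = path R E a q := sub_eq_zero.1 ((TwoSidedIdeal.mem_bot _).1 hmem)
    -- For `d = 1` the indicator of level `0`, evaluated at level `0`, separates `a` from `q`: the
    -- vertex gives `1`, while `q` reads level `-|q|` and gives `0`.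
    have h := congrFun (LinearMap.congr_fun (congrArg ((fullSystem E 1).rep R) hzero)
      fun x => if x.2.2 = 0 then 1 else 0) (a, 0, 0)
    rw [BranchingSystem.rep_vertex_apply,
      if_pos (mem_fullSystem_carrier (x := (a, 0, 0)).2 rfl), fullSystem,
      BranchingSystem.rep_graded_path_apply R hpath hex] at h
    simp [hne] at h
  · rw [← one_smul R (vertex R E x)] at hx
    exact (fullSystem E 0).smul_vertex_notMem_ker R
      (BranchingSystem.carrier_graded_nonempty (Set.notMem_empty x)) one_ne_zero hx

/-- There is a basic ideal that contains the vertex `a` and only such vertices as reach a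
descendant of `a` from each of their descendants. -/
theorem exists_isBasic_vertex_mem [Nontrivial R] (a : V) :
    ∃ I : TwoSidedIdeal (LeavittPathAlgebra R E), IsBasic I ∧ vertex R E a ∈ I ∧
      ∀ x, vertex R E x ∈ I → ∀ y, E.Reaches x y → ∃ z, E.Reaches y z ∧ E.Reaches a z := by
  set H : Set V := {x | ∀ y, E.Reaches x y → ∃ z, E.Reaches y z ∧ E.Reaches a z} with hHdef
  have hH : ∀ e, E.s e ∈ H → E.r e ∈ H := fun e he y hy => he y ((E.reaches_edge e).trans hy)
  -- A nontrivial path from `u` passes through the range of an edge leaving `u`, which is in `H`;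
  -- for the trivial path any outgoing edge serves.
  have hsat : ∀ u, (∃ e, E.s e = u) → (∀ e, E.s e = u → E.r e ∈ H) → u ∈ H := by
    rintro _ ⟨e, rfl⟩ h y ⟨p, hp⟩
    cases p with
    | nil =>
      cases hp
      obtain ⟨z, hz, hz'⟩ := h e rfl _ (.refl _)
      exact ⟨z, (DirectedGraph.reaches_edge e).trans hz, hz'⟩
    | cons f p => exact h f hp.1 y ⟨p, hp.2⟩
  refine ⟨(BranchingSystem.graded E 0 H hH hsat).ker R, BranchingSystem.isBasic_ker _ R,
    BranchingSystem.vertex_mem_ker _ R (BranchingSystem.carrier_graded_eq_empty ?_),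
    fun x hx => ?_⟩
  · exact fun y hy => ⟨y, .refl y, hy⟩
  · change x ∈ H
    by_contra hxH
    rw [← one_smul R (vertex R E x)] at hx
    exact BranchingSystem.smul_vertex_notMem_ker _ R
      (BranchingSystem.carrier_graded_nonempty hxH) one_ne_zero hx

theorem conditionL_of_forall [Nontrivial R]
    (h : ∀ I : TwoSidedIdeal (LeavittPathAlgebra R E), I ≠ ⊥ → IsBasic I →
      ∃ x, vertex R E x ∈ I) : E.ConditionL := by
  by_contra hL
  obtain ⟨I, hI, hb, hn⟩ := exists_ne_bot_of_not_conditionL (R := R) hL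
  obtain ⟨x, hx⟩ := h I hI hb
  exact hn x hx

/-- A vertex common to the two ideals reaches a descendant `y` of `a` by the first ideal. As `y` is
its descendant, the second ideal provides a vertex below both `y` and `b`. -/
theorem conditionMT3_of_forall [Nontrivial R]
    (h : ∀ I J : TwoSidedIdeal (LeavittPathAlgebra R E), I ≠ ⊥ → J ≠ ⊥ → IsBasic I → IsBasic J →
      ∃ x, vertex R E x ∈ I ∧ vertex R E x ∈ J) : E.ConditionMT3 := by
  intro a b
  obtain ⟨I, hI, ha, hIa⟩ := exists_isBasic_vertex_mem (R := R) (E := E) a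
  obtain ⟨J, hJ, hb, hJb⟩ := exists_isBasic_vertex_mem (R := R) (E := E) b
  have hne : ∀ {I : TwoSidedIdeal (LeavittPathAlgebra R E)} {a}, vertex R E a ∈ I → I ≠ ⊥ := by
    rintro I a ha rfl
    exact vertex_ne_zero a ((TwoSidedIdeal.mem_bot _).1 ha)
  obtain ⟨x, hxI, hxJ⟩ := h I J (hne ha) (hne hb) hI hJ
  obtain ⟨y, hxy, hay⟩ := hIa x hxI x (.refl x)
  obtain ⟨z, hyz, hbz⟩ := hJb x hxJ y hxy
  exact ⟨z, hay.trans hyz, hbz⟩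

theorem isField_of_forall [Nontrivial R] [Nonempty V]
    (h : ∀ I : TwoSidedIdeal (LeavittPathAlgebra R E), I ≠ ⊥ → ∃ x, vertex R E x ∈ I) :
    IsField R := by
  refine ⟨exists_pair_ne R, mul_comm, fun {t} ht => ?_⟩
  obtain ⟨x, hx⟩ := h (smulIdeal R E t) fun hbot => by
    refine smul_vertex_ne_zero (E := E) ht (Classical.arbitrary V) ?_
    rw [← TwoSidedIdeal.mem_bot, ← hbot]
    exact mem_smulIdeal.2 ⟨_, rfl⟩
  obtain ⟨a, ha⟩ := mem_smulIdeal.1 hx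
  exact (isUnit_of_vertex_eq_smul ha).exists_right_inv

end LeavittPathAlgebra

theorem proposition6p2 {V : Type u} {Ed : Type v} [Countable V] [Countable Ed] [Nonempty V]
    (E : DirectedGraph V Ed) (R : Type w) [CommRing R] [Nontrivial R] :
    (E.ConditionL ↔
      ∀ I : TwoSidedIdeal (LeavittPathAlgebra R E), I ≠ ⊥ → LeavittPathAlgebra.IsBasic I →
        ∃ x : V, LeavittPathAlgebra.vertex R E x ∈ I) ∧
    (E.ConditionL ∧ E.ConditionMT3 ↔
      ∀ I J : TwoSidedIdeal (LeavittPathAlgebra R E), I ≠ ⊥ → J ≠ ⊥ →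
        LeavittPathAlgebra.IsBasic I → LeavittPathAlgebra.IsBasic J →
        ∃ x : V, LeavittPathAlgebra.vertex R E x ∈ I ∧ LeavittPathAlgebra.vertex R E x ∈ J) ∧
    (IsField R ∧ E.ConditionL ∧ E.ConditionMT3 ↔
      ∀ I J : TwoSidedIdeal (LeavittPathAlgebra R E), I ≠ ⊥ → J ≠ ⊥ →
        ∃ x : V, LeavittPathAlgebra.vertex R E x ∈ I ∧
          LeavittPathAlgebra.vertex R E x ∈ J) := by
  open LeavittPathAlgebra in
  refine ⟨⟨fun hL I hI hb => exists_vertex_mem hL hI hb, conditionL_of_forall⟩,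
    ⟨fun h I J hI hJ hIb hJb => exists_vertex_mem_inf h.1 h.2 hI hJ hIb hJb, fun h => ⟨?_, ?_⟩⟩,
    ⟨fun h I J hI hJ => exists_vertex_mem_inf h.2.1 h.2.2 hI hJ (isBasic_of_isField h.1 I)
      (isBasic_of_isField h.1 J), fun h => ⟨?_, ?_, ?_⟩⟩⟩
  -- Statements about one ideal are the case `I = J` of those about two.
  · exact conditionL_of_forall fun I hI hb => (h I I hI hI hb hb).imp fun _ hx => hx.1
  · exact conditionMT3_of_forall h
  · exact isField_of_forall fun I hI => (h I I hI hI).imp fun _ hx => hx.1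
  · exact conditionL_of_forall fun I hI _ => (h I I hI hI).imp fun _ hx => hx.1
  · exact conditionMT3_of_forall fun I J hI hJ _ _ => h I J hI hJ
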